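/- Let $\Bbbk$ be an algebraically closed field of characteristic $0$, let $n\ge 1$ and $0\le v\le n-1$ be integers, let $\xi\in\Bbbk$ be a primitive $n$-th root of unity, and put $m:=n/\gcd(n,v)$. For $q\in\Bbbk$ write $l!_q:=\prod_{i=1}^{l}(1+q+\dots+q^{i-1})$. Let $T_\infty(n,v,\xi)$ be the Hopf algebra generated by $g,x$ with relations $g^n=1$, $xg=\xi gx$ and $$\Delta(g)=g\otimes g,\quad \Delta(x)=1\otimes x+x\otimes g^v,\quad \varepsilon(g)=1,\quad \varepsilon(x)=0,\quad S(g)=g^{n-1},\quad S(x)=-\xi^{-v}g^{n-v}x.$$ Its finite dual $T_\infty(n,v,\xi)^\circ$ is the set of linear functionals that vanish on some two-sided ideal of finite codimension, with the standard Hopf algebra structure: the product is convolution, $\langle fh,a\rangle=\sum\langle f,a_{(1)}\rangle\langle h,a_{(2)}\rangle$, the unit is $\varepsilon$, the coproduct is determined by $\sum\langle f_{(1)},a\rangle\langle f_{(2)},b\rangle=\langle f,ab\rangle$, the counit is $f\mapsto f(1)$, and the antipode is $f\mapsto f\circ S$. Let $T_{\infty^\circ}(n,v,\xi)$ be the algebra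 generated by $\Psi_\lambda$ ($\lambda\in\Bbbk$), $\Omega$, $F_1$, $F_2$ with relations, for all $\lambda,\lambda_1,\lambda_2\in\Bbbk$, $$\Psi_{\lambda_1}\Psi_{\lambda_2}=\Psi_{\lambda_1+\lambda_2},\quad \Psi_0=1,\quad \Omega^n=1,\quad F_1^m=0,$$ $$\Omega\Psi_\lambda=\Psi_\lambda\Omega,\quad F_2\Omega=\Omega F_2,\quad F_1\Omega=\xi^v\Omega F_1,\quad F_2\Psi_\lambda=\Psi_\lambda F_2,\quad F_1\Psi_\lambda=\Psi_\lambda F_1,\quad F_1F_2=F_2F_1 .$$ Put $F_1^{[k]}:=\frac{1}{k!_{\xi^v}}F_1^k$ for $1\le k\le m-1$, and $\varsigma_c:=\frac mn\sum_{i=0}^{n/m-1}\xi^{-imc}\,\Omega^{im}$ for $0\le c<n/m$. (1) $T_{\infty^\circ}(n,v,\xi)$ is a Hopf algebra with comultiplication, counit and antipode given on the generators by $$\Delta(\Omega)=\Omega\otimes\Omega,\qquad \Delta(F_1)=1\otimes F_1+F_1\otimes\Omega,$$ $$\Delta(F_2)=1\otimes F_2+F_2\otimes\Omega^m+\sum_{k=1}^{m-1}F_1^{[k]}\otimes\Omega^kF_1^{[m-k]},$$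 $$\Delta(\Psi_\lambda)=\sum_{c=0}^{n/m-1}\bigl(\Psi_{\lambda\xi^{mc}}\otimes\Psi_\lambda\varsigma_c\bigr)\Bigl(1\otimes1+\lambda\sum_{k=1}^{m-1}F_1^{[k]}\otimes\Omega^kF_1^{[m-k]}\Bigr),$$ $$\varepsilon(\Omega)=\varepsilon(\Psi_\lambda)=1,\qquad \varepsilon(F_1)=\varepsilon(F_2)=0,$$ $$S(\Omega)=\Omega^{n-1},\quad S(F_1)=-\xi^{-v}\Omega^{n-1}F_1,\quad S(F_2)=-\Omega^{n-m}F_2,\quad S(\Psi_\lambda)=\sum_{c=0}^{n/m-1}\Psi_{-\lambda\xi^{-mc}}\,\varsigma_c .$$ (2) There is an isomorphism of Hopf algebras $\Theta:T_{\infty^\circ}(n,v,\xi)\to T_\infty(n,v,\xi)^\circ$ with $\Psi_\lambda\mapsto\psi_\lambda$, $\Omega\mapsto\omega$, $F_2\mapsto E_2$, and $F_1\mapsto E_1$ if $v\ne0$ (if $v=0$ then $m=1$, and $F_1=0\mapsto0$), where for all $j,l\ge0$ $$\psi_\lambda(g^jx^l)=\begin{cases}\lambda^{l/m}& m\mid l\\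 0&\text{otherwise}\end{cases},\qquad \omega(g^jx^l)=\delta_{l,0}\,\xi^j,\qquad E_1(g^jx^l)=\delta_{l,1},\qquad E_2(g^jx^l)=\delta_{l,m}$$ (with $\lambda^0=1$ also for $\lambda=0$). -/

import Mathlib

open scoped TensorProduct

noncomputable section

/-! ## Hopf algebra structures on a given algebra -/

/-- A Hopf algebra structure on a given `k`-algebra `A`: comultiplication, counit and antipode
satisfying the Hopf algebra axioms. -/
structure HopfStructure (k A : Type*) [CommRing k] [Ring A] [Algebra k A] where
  comul : A →ₐ[k] A ⊗[k] A
  counit : A →ₐ[k] k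
  antipode : A →ₗ[k] A
  coassoc : (Algebra.TensorProduct.assoc k k k A A A).toAlgHom.comp
      ((Algebra.TensorProduct.map comul (.id k A)).comp comul)
      = (Algebra.TensorProduct.map (.id k A) comul).comp comul
  counit_left : (Algebra.TensorProduct.map counit (.id k A)).comp comul
      = (Algebra.TensorProduct.lid k A).symm
  counit_right : (Algebra.TensorProduct.map (.id k A) counit).comp comul
      = (Algebra.TensorProduct.rid k k A).symm
  antipode_left : ∀ a, LinearMap.mul' k A (antipode.rTensor A (comul a)) = algebraMap k A (counit a)
  antipode_right : ∀ a, LinearMap.mul' k A (antipode.lTensor A (comul a)) = algebraMap k A (counit a)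

namespace HopfStructure

variable {k A : Type*} [CommRing k] [Ring A] [Algebra k A]

/-- The corresponding instance of Mathlib's class; the underlying algebra is the given one. -/
abbrev toHopfAlgebra (M : HopfStructure k A) : HopfAlgebra k A :=
  letI : Bialgebra k A :=
    Bialgebra.ofAlgHom M.comul M.counit M.coassoc M.counit_left M.counit_right
  { antipode := M.antipode
    mul_antipode_rTensor_comul := LinearMap.ext M.antipode_left
    mul_antipode_lTensor_comul := LinearMap.ext M.antipode_right }

/-- The antipode axioms need only be checked on algebra generators if the antipode is given as an
anti-homomorphism. -/
theorem antipode_left_of_adjoin (Δ : A →ₐ[k] A ⊗[k] A) (ε : A →ₐ[k] k) (S : A →ₐ[k] Aᵐᵒᵖ)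
    (s : Set A) (hs : Algebra.adjoin k s = ⊤)
    (h : ∀ a ∈ s, LinearMap.mul' k A
      ((((MulOpposite.opLinearEquiv k).symm.toLinearMap ∘ₗ S.toLinearMap)).rTensor A (Δ a)) =
        algebraMap k A (ε a)) (a : A) :
    LinearMap.mul' k A
      ((((MulOpposite.opLinearEquiv k).symm.toLinearMap ∘ₗ S.toLinearMap)).rTensor A (Δ a)) =
        algebraMap k A (ε a) := by
  set σ : A →ₗ[k] A := (MulOpposite.opLinearEquiv k).symm.toLinearMap ∘ₗ S.toLinearMap with hσ
  have σ1 : σ 1 = 1 := by simp [hσ]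
  have σm : ∀ x y, σ (x * y) = σ y * σ x := fun x y => by simp [hσ]
  have key1 : ∀ (t : A ⊗[k] A) (x y : A), LinearMap.mul' k A (σ.rTensor A (t * (x ⊗ₜ y))) =
      σ x * LinearMap.mul' k A (σ.rTensor A t) * y := by
    intro t x y
    induction t with
    | zero => simp
    | tmul p q => simp [σm, mul_assoc]
    | add p q hp hq => rw [add_mul, map_add, map_add, hp, hq, map_add, map_add, mul_add, add_mul]
  have key2 : ∀ (t u : A ⊗[k] A) (c : k),
      LinearMap.mul' k A (σ.rTensor A t) = algebraMap k A c →
      LinearMap.mul' k A (σ.rTensor A (t * u)) =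
        algebraMap k A c * LinearMap.mul' k A (σ.rTensor A u) := by
    intro t u c hc
    induction u with
    | zero => simp
    | tmul p q => rw [key1, hc, ← Algebra.commutes]; simp [mul_assoc]
    | add p q hp hq => rw [mul_add, map_add, map_add, hp, hq, map_add, map_add, mul_add]
  have ha : a ∈ Algebra.adjoin k s := by rw [hs]; trivial
  induction ha using Algebra.adjoin_induction with
  | mem x hx => exact h x hx
  | algebraMap r => simp [Algebra.algebraMap_eq_smul_one, Algebra.TensorProduct.one_def, σ1]
  | add x y _ _ hx hy => simp only [map_add, hx, hy]
  | mul x y _ _ hx hy => rw [map_mul, key2 _ _ _ hx, hy, map_mul, map_mul]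

theorem antipode_right_of_adjoin (Δ : A →ₐ[k] A ⊗[k] A) (ε : A →ₐ[k] k) (S : A →ₐ[k] Aᵐᵒᵖ)
    (s : Set A) (hs : Algebra.adjoin k s = ⊤)
    (h : ∀ a ∈ s, LinearMap.mul' k A
      ((((MulOpposite.opLinearEquiv k).symm.toLinearMap ∘ₗ S.toLinearMap)).lTensor A (Δ a)) =
        algebraMap k A (ε a)) (a : A) :
    LinearMap.mul' k A
      ((((MulOpposite.opLinearEquiv k).symm.toLinearMap ∘ₗ S.toLinearMap)).lTensor A (Δ a)) =
        algebraMap k A (ε a) := by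
  set σ : A →ₗ[k] A := (MulOpposite.opLinearEquiv k).symm.toLinearMap ∘ₗ S.toLinearMap with hσ
  have σ1 : σ 1 = 1 := by simp [hσ]
  have σm : ∀ x y, σ (x * y) = σ y * σ x := fun x y => by simp [hσ]
  have key1 : ∀ (t : A ⊗[k] A) (x y : A), LinearMap.mul' k A (σ.lTensor A ((x ⊗ₜ y) * t)) =
      x * LinearMap.mul' k A (σ.lTensor A t) * σ y := by
    intro t x y
    induction t with
    | zero => simp
    | tmul p q => simp [σm, mul_assoc]
    | add p q hp hq => rw [mul_add, map_add, map_add, hp, hq, map_add, map_add, mul_add, add_mul]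
  have key2 : ∀ (t u : A ⊗[k] A) (c : k),
      LinearMap.mul' k A (σ.lTensor A t) = algebraMap k A c →
      LinearMap.mul' k A (σ.lTensor A (u * t)) =
        algebraMap k A c * LinearMap.mul' k A (σ.lTensor A u) := by
    intro t u c hc
    induction u with
    | zero => simp
    | tmul p q => rw [key1, hc, ← Algebra.commutes]; simp [mul_assoc]
    | add p q hp hq => rw [add_mul, map_add, map_add, hp, hq, map_add, map_add, mul_add]
  have ha : a ∈ Algebra.adjoin k s := by rw [hs]; trivial
  induction ha using Algebra.adjoin_induction with
  | mem x hx => exact h x hx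
  | algebraMap r => simp [Algebra.algebraMap_eq_smul_one, Algebra.TensorProduct.one_def, σ1]
  | add x y _ _ hx hy => simp only [map_add, hx, hy]
  | mul x y _ _ hx hy =>
    rw [map_mul, key2 _ _ _ hy, hx, map_mul, map_mul, ← map_mul, mul_comm, map_mul]

end HopfStructure

/-! ## The finite dual of a Hopf algebra -/

section FiniteDual

variable (k H : Type*) [Field k] [Ring H] [HopfAlgebra k H]

/-- `f` vanishes on a two-sided ideal of finite codimension. -/
def VanishesOnCofinite (f : H →ₗ[k] k) : Prop :=
  ∃ I : Ideal H, I.IsTwoSided ∧ Module.Finite k (H ⧸ I) ∧ ∀ a ∈ I, f a = 0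

variable {k H}

theorem VanishesOnCofinite.of_algHom {B : Type*} [Ring B] [Algebra k B] [Module.Finite k B]
    (φ : H →ₐ[k] B) (β : B →ₗ[k] k) : VanishesOnCofinite k H (β ∘ₗ φ.toLinearMap) := by
  refine ⟨RingHom.ker φ, inferInstance, ?_, fun a ha => ?_⟩
  · exact Module.Finite.of_injective (Ideal.kerLiftAlg φ).toLinearMap (Ideal.kerLiftAlg_injective φ)
  · have : φ a = 0 := ha
    simp [this]

theorem VanishesOnCofinite.exists_algHom {f : H →ₗ[k] k} (hf : VanishesOnCofinite k H f) :
    ∃ (I : Ideal H) (_ : I.IsTwoSided) (_ : Module.Finite k (H ⧸ I)) (β : (H ⧸ I) →ₗ[k] k),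
      f = β ∘ₗ (Ideal.Quotient.mkₐ k I).toLinearMap := by
  obtain ⟨I, hI, hfin, h⟩ := hf
  refine ⟨I, hI, hfin, (I.restrictScalars k).liftQ f h, ?_⟩
  ext a
  rfl

variable (k H)

/-- The finite dual `H°` as a subalgebra of the convolution algebra `H* = Hom(H, k)`
(with `(f * g) h = ∑ f h₁ * g h₂` and unit the counit of `H`). -/
def finiteDualSubalgebra : Subalgebra k (WithConv (H →ₗ[k] k)) where
  carrier := {f | VanishesOnCofinite k H f.ofConv}
  mul_mem' := by
    intro f g hf hg
    obtain ⟨I, _, _, β, hβ⟩ := VanishesOnCofinite.exists_algHom hf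
    obtain ⟨J, _, _, γ, hγ⟩ := VanishesOnCofinite.exists_algHom hg
    have := VanishesOnCofinite.of_algHom
      ((Algebra.TensorProduct.map (Ideal.Quotient.mkₐ k I) (Ideal.Quotient.mkₐ k J)).comp
        (Bialgebra.comulAlgHom k H)) (LinearMap.mul' k k ∘ₗ TensorProduct.map β γ)
    convert this
    rw [LinearMap.convMul_def, hβ, hγ, TensorProduct.map_comp]
    rfl
  add_mem' := by
    intro f g hf hg
    obtain ⟨I, _, _, β, hβ⟩ := VanishesOnCofinite.exists_algHom hf
    obtain ⟨J, _, _, γ, hγ⟩ := VanishesOnCofinite.exists_algHom hg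
    have := VanishesOnCofinite.of_algHom
      ((Ideal.Quotient.mkₐ k I).prod (Ideal.Quotient.mkₐ k J)) (LinearMap.coprod β γ)
    change VanishesOnCofinite k H (f.ofConv + g.ofConv)
    convert this using 1
    rw [hβ, hγ]
    ext a
    simp
  algebraMap_mem' := by
    intro c
    have := VanishesOnCofinite.of_algHom (Bialgebra.counitAlgHom k H)
      (c • LinearMap.id : k →ₗ[k] k)
    change VanishesOnCofinite k H (algebraMap k (WithConv (H →ₗ[k] k)) c).ofConv
    convert this using 1
    ext a
    simp

/-- The finite dual `H°` with its algebra structure. -/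
def FiniteDual : Type _ := finiteDualSubalgebra k H

namespace FiniteDual

variable {k H}

instance : Ring (FiniteDual k H) := inferInstanceAs (Ring (finiteDualSubalgebra k H))

instance instAlgebra : Algebra k (FiniteDual k H) :=
  inferInstanceAs (Algebra k (finiteDualSubalgebra k H))

/-- Evaluation of an element of the finite dual, as a linear functional. -/
def toDual : FiniteDual k H →ₗ[k] (H →ₗ[k] k) where
  toFun f := f.1.ofConv
  map_add' _ _ := rfl
  map_smul' _ _ := rfl

theorem toDual_injective : Function.Injective (toDual (k := k) (H := H)) :=
  fun _ _ h => Subtype.ext (WithConv.ext h)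

@[simp] theorem toDual_one (a : H) : toDual (1 : FiniteDual k H) a = Coalgebra.counit (R := k) a :=
  rfl

theorem toDual_mul (f g : FiniteDual k H) (a : H) : toDual (f * g) a =
    LinearMap.mul' k k (TensorProduct.map (toDual f) (toDual g) (Coalgebra.comul a)) := rfl

/-- The pairing `M ⊗ N → (A ⊗ B)*` induced by `p : M → A*` and `q : N → B*`. -/
def pair {A B M N : Type*} [AddCommGroup A] [Module k A] [AddCommGroup B] [Module k B]
    [AddCommGroup M] [Module k M] [AddCommGroup N] [Module k N]
    (p : M →ₗ[k] (A →ₗ[k] k)) (q : N →ₗ[k] (B →ₗ[k] k)) :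
    M ⊗[k] N →ₗ[k] (A ⊗[k] B →ₗ[k] k) :=
  TensorProduct.dualDistrib k A B ∘ₗ TensorProduct.map p q

section pair

variable {A B M N : Type*} [AddCommGroup A] [Module k A] [AddCommGroup B] [Module k B]
    [AddCommGroup M] [Module k M] [AddCommGroup N] [Module k N]
    (p : M →ₗ[k] (A →ₗ[k] k)) (q : N →ₗ[k] (B →ₗ[k] k))

@[simp] theorem pair_tmul (m : M) (n : N) (a : A) (b : B) :
    pair p q (m ⊗ₜ n) (a ⊗ₜ b) = p m a * q n b := rfl

theorem pair_injective (hp : Function.Injective p) (hq : Function.Injective q) :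
    Function.Injective (pair p q) := by
  rw [injective_iff_map_eq_zero]
  intro t ht
  classical
  let bs := Module.Basis.ofVectorSpace k N
  obtain ⟨c, rfl⟩ := (TensorProduct.equivFinsuppOfBasisRight (M := M) bs).symm.surjective t
  suffices c = 0 by simp [this]
  ext i
  apply hp
  ext a
  have h1 : ∀ b, q (c.sum fun i m => p m a • bs i) b = 0 := by
    intro b
    have := LinearMap.congr_fun ht (a ⊗ₜ b)
    rw [TensorProduct.equivFinsuppOfBasisRight_symm_apply] at this
    simpa [Finsupp.sum, map_sum, LinearMap.sum_apply] using this
  have h2 : (c.sum fun i m => p m a • bs i) = 0 := by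
    apply hq
    ext b
    simpa using h1 b
  have h3 := linearIndependent_iff'.1 bs.linearIndependent c.support (fun i => p (c i) a) h2
  by_cases hi : i ∈ c.support
  · simpa using h3 i hi
  · simp [Finsupp.notMem_support_iff.1 hi]

end pair

/-- The map `H° ⊗ H° → (H ⊗ H)*`. -/
def pair₂ : FiniteDual k H ⊗[k] FiniteDual k H →ₗ[k] (H ⊗[k] H →ₗ[k] k) := pair toDual toDual

@[simp] theorem pair₂_tmul (f g : FiniteDual k H) (a b : H) :
    pair₂ (f ⊗ₜ g) (a ⊗ₜ b) = toDual f a * toDual g b := rfl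

theorem pair₂_injective : Function.Injective (pair₂ (k := k) (H := H)) :=
  pair_injective _ _ toDual_injective toDual_injective

/-- The map `f ↦ (a ⊗ b ↦ f (a b))`. -/
def mulDual : FiniteDual k H →ₗ[k] (H ⊗[k] H →ₗ[k] k) :=
  (LinearMap.mul' k H).dualMap ∘ₗ toDual

@[simp] theorem mulDual_tmul (f : FiniteDual k H) (a b : H) :
    mulDual f (a ⊗ₜ b) = toDual f (a * b) := rfl

theorem mulDual_mem (f : FiniteDual k H) : mulDual f ∈ LinearMap.range (pair₂ (k := k) (H := H)) := by
  obtain ⟨I, _, _, β, hβ⟩ := VanishesOnCofinite.exists_algHom f.2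
  let bs := Module.finBasis k (H ⧸ I)
  let φ := Ideal.Quotient.mkₐ k I
  refine ⟨∑ i, (show FiniteDual k H from ⟨WithConv.toConv (bs.coord i ∘ₗ φ.toLinearMap),
      VanishesOnCofinite.of_algHom φ _⟩) ⊗ₜ
    (show FiniteDual k H from ⟨WithConv.toConv ((β ∘ₗ LinearMap.mulLeft k (bs i)) ∘ₗ φ.toLinearMap),
      VanishesOnCofinite.of_algHom φ _⟩), ?_⟩
  ext a b
  have h : toDual f (a * b) = β (φ a * φ b) := by
    rw [← map_mul]
    exact LinearMap.congr_fun hβ (a * b)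
  simp only [TensorProduct.AlgebraTensorModule.curry_apply, LinearMap.restrictScalars_self,
    TensorProduct.curry_apply, map_sum, LinearMap.sum_apply, mulDual_tmul]
  rw [h]
  conv_rhs => rw [← bs.sum_repr (φ a), Finset.sum_mul, map_sum]
  refine Finset.sum_congr rfl fun i _ => ?_
  rw [smul_mul_assoc, map_smul]
  rfl

/-- The comultiplication of `H°`, characterised by `∑ f₁ a * f₂ b = f (a b)`. -/
def comul : FiniteDual k H →ₗ[k] FiniteDual k H ⊗[k] FiniteDual k H :=
  (LinearEquiv.ofInjective pair₂ pair₂_injective).symm.toLinearMap ∘ₗ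
    mulDual.codRestrict (LinearMap.range pair₂) mulDual_mem

theorem pair₂_comul (f : FiniteDual k H) : pair₂ (comul f) = mulDual f := by
  have := (LinearEquiv.ofInjective (pair₂ (k := k) (H := H)) pair₂_injective).apply_symm_apply
    (mulDual.codRestrict (LinearMap.range pair₂) mulDual_mem f)
  exact congrArg Subtype.val this

theorem pair₂_mul (s t : FiniteDual k H ⊗[k] FiniteDual k H) (u : H ⊗[k] H) :
    pair₂ (s * t) u = LinearMap.mul' k k (TensorProduct.map (pair₂ s) (pair₂ t)
      (Coalgebra.comul u)) := by
  induction s with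
  | zero => simp
  | add x y hx hy => simp only [add_mul, map_add, LinearMap.add_apply, hx, hy,
      TensorProduct.map_add_left]
  | tmul f g =>
  induction t with
  | zero => simp
  | add x y hx hy => simp only [mul_add, map_add, LinearMap.add_apply, hx, hy,
      TensorProduct.map_add_right]
  | tmul f' g' =>
  induction u with
  | zero => simp
  | add x y hx hy => simp only [map_add, hx, hy]
  | tmul a b =>
    rw [Algebra.TensorProduct.tmul_mul_tmul, pair₂_tmul, toDual_mul, toDual_mul,
      TensorProduct.comul_tmul]
    generalize Coalgebra.comul (R := k) a = x
    generalize Coalgebra.comul (R := k) b = y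
    induction x with
    | zero => simp
    | add x y hx hy => simp only [map_add, add_mul, hx, hy, TensorProduct.add_tmul]
    | tmul a₁ a₂ =>
    induction y with
    | zero => simp
    | add x y hx hy => simp only [map_add, mul_add, hx, hy, TensorProduct.tmul_add]
    | tmul b₁ b₂ =>
      simp
      ring

/-- The comultiplication as an algebra homomorphism. -/
def comulAlgHom : FiniteDual k H →ₐ[k] FiniteDual k H ⊗[k] FiniteDual k H :=
  .ofLinearMap comul
    (by
      apply pair₂_injective
      rw [pair₂_comul]
      ext a b
      simp [Algebra.TensorProduct.one_def])
    (by
      intro f g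
      apply pair₂_injective
      ext a b
      simp only [TensorProduct.AlgebraTensorModule.curry_apply, LinearMap.restrictScalars_self,
        TensorProduct.curry_apply]
      rw [pair₂_mul, pair₂_comul, pair₂_comul, pair₂_comul, mulDual_tmul, toDual_mul,
        Bialgebra.comul_mul, TensorProduct.comul_tmul]
      generalize Coalgebra.comul (R := k) a = x
      generalize Coalgebra.comul (R := k) b = y
      induction x with
      | zero => simp
      | add x y hx hy => simp only [map_add, add_mul, hx, hy, TensorProduct.add_tmul]
      | tmul a₁ a₂ =>
      induction y with
      | zero => simp
      | add x y hx hy => simp only [map_add, mul_add, hx, hy, TensorProduct.tmul_add]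
      | tmul b₁ b₂ => simp)

@[simp] theorem comulAlgHom_apply (f : FiniteDual k H) : comulAlgHom f = comul f := rfl

/-- The counit of `H°`, evaluation at `1`. -/
def counitAlgHom : FiniteDual k H →ₐ[k] k :=
  .ofLinearMap (LinearMap.applyₗ (1 : H) ∘ₗ toDual) (by simp)
    (by intro f g; simp [toDual_mul, Algebra.TensorProduct.one_def])

@[simp] theorem counitAlgHom_apply (f : FiniteDual k H) : counitAlgHom f = toDual f 1 := rfl

/-- The antipode of `H°`, precomposition with the antipode of `H`. -/
def antipode : FiniteDual k H →ₗ[k] FiniteDual k H where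
  toFun f := ⟨WithConv.toConv (toDual f ∘ₗ HopfAlgebra.antipode k), by
    obtain ⟨I, _, _, β, hβ⟩ := VanishesOnCofinite.exists_algHom f.2
    have hS : toDual f ∘ₗ HopfAlgebra.antipode k =
        (β ∘ₗ (MulOpposite.opLinearEquiv k).symm.toLinearMap) ∘ₗ
          (AlgHom.ofLinearMap ((MulOpposite.opLinearEquiv k).toLinearMap ∘ₗ
            (Ideal.Quotient.mkₐ k I).toLinearMap ∘ₗ HopfAlgebra.antipode k)
            (by simp) (by intro a b; simp [HopfAlgebra.antipode_mul_antidistrib]) :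
          H →ₐ[k] (H ⧸ I)ᵐᵒᵖ).toLinearMap := by
      have hβ' : toDual f = β ∘ₗ (Ideal.Quotient.mkₐ k I).toLinearMap := hβ
      rw [hβ']
      ext a
      rfl
    change VanishesOnCofinite k H (toDual f ∘ₗ HopfAlgebra.antipode k)
    rw [hS]
    exact VanishesOnCofinite.of_algHom _ _⟩
  map_add' _ _ := rfl
  map_smul' _ _ := rfl

@[simp] theorem toDual_antipode (f : FiniteDual k H) (a : H) :
    toDual (antipode f) a = toDual f (HopfAlgebra.antipode k a) := rfl

/-- The standard Hopf algebra structure on the finite dual. -/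
def hopfStructure : HopfStructure k (FiniteDual k H) where
  comul := comulAlgHom
  counit := counitAlgHom
  antipode := antipode
  coassoc := by
    apply AlgHom.ext
    intro f
    apply pair_injective (toDual (k := k) (H := H)) pair₂ toDual_injective pair₂_injective
    have hl : ∀ (t : FiniteDual k H ⊗[k] FiniteDual k H) (a b c : H), pair toDual pair₂
        (Algebra.TensorProduct.assoc k k k _ _ _ (Algebra.TensorProduct.map comulAlgHom
          (.id k (FiniteDual k H)) t)) (a ⊗ₜ (b ⊗ₜ c)) = pair₂ t ((a * b) ⊗ₜ c) := by
      intro t a b c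
      induction t with
      | zero => simp
      | add x y hx hy => simp only [map_add, LinearMap.add_apply, hx, hy]
      | tmul f g =>
        rw [pair₂_tmul, ← mulDual_tmul, ← pair₂_comul, Algebra.TensorProduct.map_tmul]
        change pair toDual pair₂ (TensorProduct.assoc k _ _ _ (comul f ⊗ₜ[k] g)) _ = _
        generalize comul f = x
        induction x with
        | zero => simp
        | add x y hx hy =>
          simp only [map_add, LinearMap.add_apply, hx, hy, add_mul, TensorProduct.add_tmul]
        | tmul f₁ f₂ => simp [mul_assoc]
    have hr : ∀ (t : FiniteDual k H ⊗[k] FiniteDual k H) (a b c : H), pair toDual pair₂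
        (Algebra.TensorProduct.map (.id k (FiniteDual k H)) comulAlgHom t) (a ⊗ₜ (b ⊗ₜ c)) =
          pair₂ t (a ⊗ₜ (b * c)) := by
      intro t a b c
      induction t with
      | zero => simp
      | add x y hx hy => simp only [map_add, LinearMap.add_apply, hx, hy]
      | tmul f g => simp [pair₂_comul]
    ext a b c
    refine (hl (comul f) a b c).trans (Eq.trans ?_ (hr (comul f) a b c).symm)
    simp [pair₂_comul, mul_assoc]
  counit_left := by
    apply AlgHom.ext
    intro f
    have h : ∀ (t : FiniteDual k H ⊗[k] FiniteDual k H) (a : H), toDual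
        (TensorProduct.lid k _ (Algebra.TensorProduct.map counitAlgHom
          (.id k (FiniteDual k H)) t)) a = pair₂ t (1 ⊗ₜ a) := by
      intro t a
      induction t with
      | zero => simp
      | add x y hx hy => simp only [map_add, LinearMap.add_apply, hx, hy]
      | tmul f g => simp
    apply (TensorProduct.lid k (FiniteDual k H)).injective
    apply toDual_injective
    ext a
    refine (h (comul f) a).trans ?_
    simp [pair₂_comul]
  counit_right := by
    apply AlgHom.ext
    intro f
    have h : ∀ (t : FiniteDual k H ⊗[k] FiniteDual k H) (a : H), toDual
        (TensorProduct.rid k _ (Algebra.TensorProduct.map (.id k (FiniteDual k H))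
          counitAlgHom t)) a = pair₂ t (a ⊗ₜ 1) := by
      intro t a
      induction t with
      | zero => simp
      | add x y hx hy => simp only [map_add, LinearMap.add_apply, hx, hy]
      | tmul f g => simp [mul_comm]
    apply (TensorProduct.rid k (FiniteDual k H)).injective
    apply toDual_injective
    ext a
    refine (h (comul f) a).trans ?_
    simp [pair₂_comul]
  antipode_left := by
    intro f
    have h : ∀ (t : FiniteDual k H ⊗[k] FiniteDual k H) (a : H), toDual
        (LinearMap.mul' k _ (antipode.rTensor _ t)) a =
          pair₂ t ((HopfAlgebra.antipode k).rTensor H (Coalgebra.comul a)) := by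
      intro t a
      induction t with
      | zero => simp
      | add x y hx hy => simp only [map_add, LinearMap.add_apply, hx, hy]
      | tmul f g =>
        simp only [LinearMap.rTensor_tmul, LinearMap.mul'_apply, toDual_mul]
        generalize Coalgebra.comul (R := k) a = x
        induction x with
        | zero => simp
        | add x y hx hy => simp only [map_add, hx, hy]
        | tmul f₁ f₂ => simp
    have h' : ∀ u : H ⊗[k] H, mulDual f u = toDual f (LinearMap.mul' k H u) := fun _ => rfl
    apply toDual_injective
    ext a
    refine (h (comul f) a).trans ?_
    rw [pair₂_comul, h', HopfAlgebra.mul_antipode_rTensor_comul_apply]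
    simp [Algebra.algebraMap_eq_smul_one, mul_comm]
  antipode_right := by
    intro f
    have h : ∀ (t : FiniteDual k H ⊗[k] FiniteDual k H) (a : H), toDual
        (LinearMap.mul' k _ (antipode.lTensor _ t)) a =
          pair₂ t ((HopfAlgebra.antipode k).lTensor H (Coalgebra.comul a)) := by
      intro t a
      induction t with
      | zero => simp
      | add x y hx hy => simp only [map_add, LinearMap.add_apply, hx, hy]
      | tmul f g =>
        simp only [LinearMap.lTensor_tmul, LinearMap.mul'_apply, toDual_mul]
        generalize Coalgebra.comul (R := k) a = x
        induction x with
        | zero => simp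
        | add x y hx hy => simp only [map_add, hx, hy]
        | tmul f₁ f₂ => simp
    have h' : ∀ u : H ⊗[k] H, mulDual f u = toDual f (LinearMap.mul' k H u) := fun _ => rfl
    apply toDual_injective
    ext a
    refine (h (comul f) a).trans ?_
    rw [pair₂_comul, h', HopfAlgebra.mul_antipode_lTensor_comul_apply]
    simp [Algebra.algebraMap_eq_smul_one, mul_comm]

instance : HopfAlgebra k (FiniteDual k H) := hopfStructure.toHopfAlgebra

end FiniteDual

end FiniteDual

/-! ## Infinite dimensional Taft algebras -/

/-- Parameters: `n ≥ 1`, `0 ≤ v ≤ n - 1`, and a primitive `n`-th root of unity `ξ`. -/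
structure TaftParams (k : Type*) [Field k] where
  n : ℕ
  v : ℕ
  ξ : k
  n_pos : 0 < n
  v_lt : v < n
  primitive : IsPrimitiveRoot ξ n

/-- The generators `g`, `x`. -/
inductive TaftGen
  | g
  | x

section Taft

variable {k : Type*} [Field k] (P : TaftParams k)

/-- The defining relations `g ^ n = 1` and `x g = ξ g x`. -/
inductive TaftRel : FreeAlgebra k TaftGen → FreeAlgebra k TaftGen → Prop
  | g_pow : TaftRel (FreeAlgebra.ι k .g ^ P.n) 1
  | x_mul_g : TaftRel (FreeAlgebra.ι k .x * FreeAlgebra.ι k .g)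
      (P.ξ • (FreeAlgebra.ι k .g * FreeAlgebra.ι k .x))

/-- The algebra generated by `g` and `x` with relations `g ^ n = 1` and `x g = ξ g x`. -/
def Taft : Type _ := RingQuot (TaftRel P)

namespace Taft

instance : Ring (Taft P) := inferInstanceAs (Ring (RingQuot (TaftRel P)))

instance instAlgebra : Algebra k (Taft P) := inferInstanceAs (Algebra k (RingQuot (TaftRel P)))

/-- The quotient map from the free algebra. -/
def mk : FreeAlgebra k TaftGen →ₐ[k] Taft P := RingQuot.mkAlgHom k (TaftRel P)

def g : Taft P := mk P (FreeAlgebra.ι k .g)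

def x : Taft P := mk P (FreeAlgebra.ι k .x)

theorem g_pow_n : g P ^ P.n = 1 := by
  have := RingQuot.mkAlgHom_rel k (TaftRel.g_pow (P := P))
  rw [map_pow, map_one] at this
  exact this

theorem x_mul_g : x P * g P = P.ξ • (g P * x P) := by
  have := RingQuot.mkAlgHom_rel k (TaftRel.x_mul_g (P := P))
  rw [map_smul, map_mul, map_mul] at this
  exact this

variable {P}

/-- The universal property. -/
def lift {B : Type*} [Ring B] [Algebra k B] (a b : B) (h₁ : a ^ P.n = 1)
    (h₂ : b * a = P.ξ • (a * b)) : Taft P →ₐ[k] B :=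
  RingQuot.liftAlgHom k ⟨FreeAlgebra.lift k fun | .g => a | .x => b, by
    intro p q h
    cases h with
    | g_pow => simpa using h₁
    | x_mul_g => simpa using h₂⟩

section lift

variable {B : Type*} [Ring B] [Algebra k B] (a b : B) (h₁ : a ^ P.n = 1)
    (h₂ : b * a = P.ξ • (a * b))

@[simp] theorem lift_g : lift a b h₁ h₂ (g P) = a := by
  refine (RingQuot.liftAlgHom_mkAlgHom_apply _ _ _ _).trans ?_
  simp

@[simp] theorem lift_x : lift a b h₁ h₂ (x P) = b := by
  refine (RingQuot.liftAlgHom_mkAlgHom_apply _ _ _ _).trans ?_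
  simp

end lift

theorem adjoin_eq_top : Algebra.adjoin k {g P, x P} = ⊤ := by
  rw [eq_top_iff]
  intro a _
  obtain ⟨y, rfl⟩ := RingQuot.mkAlgHom_surjective k (TaftRel P) a
  change mk P y ∈ _
  induction y using FreeAlgebra.induction with
  | grade0 r => rw [AlgHom.commutes]; exact Subalgebra.algebraMap_mem _ r
  | grade1 c =>
    cases c with
    | g => exact Algebra.subset_adjoin (by simp [g])
    | x => exact Algebra.subset_adjoin (by simp [x])
  | mul a b ha hb => simpa using mul_mem (ha trivial) (hb trivial)
  | add a b ha hb => rw [map_add]; exact add_mem (ha trivial) (hb trivial)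

theorem algHom_ext {B : Type*} [Ring B] [Algebra k B] {φ ψ : Taft P →ₐ[k] B}
    (hg : φ (g P) = ψ (g P)) (hx : φ (x P) = ψ (x P)) : φ = ψ := by
  refine AlgHom.ext_of_adjoin_eq_top adjoin_eq_top ?_
  rintro _ (rfl | rfl)
  · exact hg
  · exact hx

theorem x_mul_g_pow (i : ℕ) : x P * g P ^ i = P.ξ ^ i • (g P ^ i * x P) := by
  induction i with
  | zero => simp
  | succ i ih =>
    rw [pow_succ, ← mul_assoc, ih, smul_mul_assoc, mul_assoc, x_mul_g, mul_smul_comm, smul_smul,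
      ← mul_assoc, ← pow_succ, ← pow_succ]

theorem ξ_ne_zero : P.ξ ≠ 0 := P.primitive.ne_zero P.n_pos.ne'

/-- `Δ(g) = g ⊗ g`, `Δ(x) = 1 ⊗ x + x ⊗ g ^ v`. -/
def comul : Taft P →ₐ[k] Taft P ⊗[k] Taft P :=
  lift (g P ⊗ₜ g P) (1 ⊗ₜ x P + x P ⊗ₜ (g P ^ P.v))
    (by rw [Algebra.TensorProduct.tmul_pow, g_pow_n, Algebra.TensorProduct.one_def])
    (by
      simp only [add_mul, mul_add, Algebra.TensorProduct.tmul_mul_tmul, one_mul, mul_one, x_mul_g,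
        TensorProduct.tmul_smul, TensorProduct.smul_tmul', smul_add]
      rw [← pow_succ, ← pow_succ'])

/-- `ε(g) = 1`, `ε(x) = 0`. -/
def counit : Taft P →ₐ[k] k := lift 1 0 (by simp) (by simp)

/-- `S(g) = g ^ (n - 1)`, `S(x) = - ξ ^ (-v) g ^ (n - v) x`, as an anti-homomorphism. -/
def antipodeAlgHom : Taft P →ₐ[k] (Taft P)ᵐᵒᵖ :=
  lift (MulOpposite.op (g P ^ (P.n - 1)))
    (MulOpposite.op (-((P.ξ⁻¹) ^ P.v • (g P ^ (P.n - P.v) * x P))))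
    (by rw [← MulOpposite.op_pow, ← pow_mul, mul_comm, pow_mul, g_pow_n, one_pow,
          MulOpposite.op_one])
    (by
      rw [← MulOpposite.op_mul, ← MulOpposite.op_mul, ← MulOpposite.op_smul]
      congr 1
      have hξ : P.ξ * P.ξ ^ (P.n - 1) = 1 := by
        rw [← pow_succ', Nat.sub_add_cancel P.n_pos, P.primitive.pow_eq_one]
      rw [neg_mul, mul_neg, smul_neg, smul_mul_assoc, mul_smul_comm, mul_assoc, x_mul_g_pow,
        mul_smul_comm, smul_comm P.ξ, smul_smul P.ξ, hξ, one_smul, ← mul_assoc, ← mul_assoc,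
        ← pow_add, ← pow_add, add_comm])

/-- The antipode of the Taft algebra. -/
def antipode : Taft P →ₗ[k] Taft P :=
  (MulOpposite.opLinearEquiv k).symm.toLinearMap ∘ₗ antipodeAlgHom.toLinearMap

theorem antipode_g : antipode (g P) = g P ^ (P.n - 1) := by simp [antipode, antipodeAlgHom]

theorem antipode_x : antipode (x P) = -((P.ξ⁻¹) ^ P.v • (g P ^ (P.n - P.v) * x P)) := by
  simp [antipode, antipodeAlgHom]

theorem antipode_mul (a b : Taft P) : antipode (a * b) = antipode b * antipode a := by
  simp [antipode]

theorem antipode_one : antipode (1 : Taft P) = 1 := by simp [antipode]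

theorem antipode_g_pow (i : ℕ) : antipode (g P ^ i) = (g P ^ (P.n - 1)) ^ i := by
  induction i with
  | zero => simp [antipode_one]
  | succ i ih => rw [pow_succ, antipode_mul, ih, antipode_g, ← pow_succ']

/-- The Hopf algebra structure of the infinite dimensional Taft algebra. -/
def hopfStructure : HopfStructure k (Taft P) where
  comul := comul
  counit := counit
  antipode := antipode
  coassoc := by
    apply algHom_ext
    · simp [comul]
    · simp [comul, TensorProduct.add_tmul, TensorProduct.tmul_add, Algebra.TensorProduct.one_def,
        add_assoc]
  counit_left := by
    apply algHom_ext
    · simp [comul, counit]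
    · simp [comul, counit]
  counit_right := by
    apply algHom_ext
    · simp [comul, counit]
    · simp [comul, counit]
  antipode_left := by
    apply HopfStructure.antipode_left_of_adjoin comul counit antipodeAlgHom _ adjoin_eq_top
    change ∀ a ∈ _, LinearMap.mul' k _ (antipode.rTensor _ _) = _
    rintro _ (rfl | rfl)
    · simp [comul, counit, antipode_g, ← pow_succ, Nat.sub_add_cancel P.n_pos, g_pow_n]
    · simp only [comul, counit, lift_x, map_add, LinearMap.rTensor_tmul, LinearMap.mul'_apply,
        antipode_x, antipode_one, one_mul, map_zero]
      rw [neg_mul, smul_mul_assoc, mul_assoc, x_mul_g_pow, mul_smul_comm, smul_smul, ← mul_pow,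
        inv_mul_cancel₀ ξ_ne_zero, one_pow, one_smul, ← mul_assoc, ← pow_add,
        Nat.sub_add_cancel P.v_lt.le, g_pow_n, one_mul, add_neg_cancel]
  antipode_right := by
    apply HopfStructure.antipode_right_of_adjoin comul counit antipodeAlgHom _ adjoin_eq_top
    change ∀ a ∈ _, LinearMap.mul' k _ (antipode.lTensor _ _) = _
    rintro _ (rfl | rfl)
    · simp [comul, counit, antipode_g, ← pow_succ', Nat.sub_add_cancel P.n_pos, g_pow_n]
    · simp only [comul, counit, lift_x, map_add, LinearMap.lTensor_tmul, LinearMap.mul'_apply,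
        antipode_x, antipode_g_pow, one_mul, map_zero]
      have h : (g P ^ (P.n - 1)) ^ P.v = g P ^ (P.n - P.v) := by
        have h1 : g P ^ (P.n - P.v) * g P ^ P.v = 1 := by
          rw [← pow_add, Nat.sub_add_cancel P.v_lt.le, g_pow_n]
        have h2 : g P ^ P.v * (g P ^ (P.n - 1)) ^ P.v = 1 := by
          rw [← pow_mul, ← pow_add, show P.v + (P.n - 1) * P.v = P.n * P.v by
            rw [Nat.sub_mul, one_mul, Nat.add_sub_cancel' (Nat.le_mul_of_pos_left _ P.n_pos)],
            pow_mul, g_pow_n, one_pow]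
        exact (left_inv_eq_right_inv h1 h2).symm
      have hξ : P.ξ⁻¹ ^ P.v = P.ξ ^ (P.n - P.v) := by
        rw [inv_pow, inv_eq_of_mul_eq_one_left]
        rw [← pow_add, Nat.sub_add_cancel P.v_lt.le, P.primitive.pow_eq_one]
      rw [h, x_mul_g_pow, hξ, neg_add_cancel]

instance : HopfAlgebra k (Taft P) := hopfStructure.toHopfAlgebra

end Taft

end Taft

/-! ## The algebra presented by `Ψ_λ`, `Ω`, `F₁`, `F₂` -/

/-- The `q`-factorial `l!_q = 1_q 2_q ⋯ l_q`, where `i_q = 1 + q + ⋯ + q ^ (i - 1)`. -/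
def qFactorial {k : Type*} [Field k] (q : k) (l : ℕ) : k :=
  ∏ i ∈ Finset.Icc 1 l, ∑ t ∈ Finset.range i, q ^ t

/-- `m = n / gcd(n, v)`. -/
def TaftParams.m {k : Type*} [Field k] (P : TaftParams k) : ℕ := P.n / Nat.gcd P.n P.v

/-- The generators `Ψ_λ` (`λ ∈ k`), `Ω`, `F₁`, `F₂`. -/
inductive TaftDualGen (k : Type*)
  | Psi (lam : k)
  | Omega
  | F₁
  | F₂

section TaftDual

variable {k : Type*} [Field k] (P : TaftParams k)

namespace TaftDualFree

/-- The generators in the free algebra. -/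
abbrev Psi (lam : k) : FreeAlgebra k (TaftDualGen k) := FreeAlgebra.ι k (.Psi lam)
abbrev Omega : FreeAlgebra k (TaftDualGen k) := FreeAlgebra.ι k .Omega
abbrev F₁ : FreeAlgebra k (TaftDualGen k) := FreeAlgebra.ι k .F₁
abbrev F₂ : FreeAlgebra k (TaftDualGen k) := FreeAlgebra.ι k .F₂

end TaftDualFree

open TaftDualFree in
/-- The defining relations. -/
inductive TaftDualRel : FreeAlgebra k (TaftDualGen k) → FreeAlgebra k (TaftDualGen k) → Prop
  | Psi_mul_Psi (a b : k) : TaftDualRel (Psi a * Psi b) (Psi (a + b))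
  | Psi_zero : TaftDualRel (Psi 0) 1
  | Omega_pow : TaftDualRel (Omega ^ P.n) 1
  | F₁_pow : TaftDualRel (F₁ ^ P.m) 0
  | Omega_mul_Psi (a : k) : TaftDualRel (Omega * Psi a) (Psi a * Omega)
  | F₂_mul_Omega : TaftDualRel (F₂ * Omega) (Omega * F₂)
  | F₁_mul_Omega : TaftDualRel (F₁ * Omega) (P.ξ ^ P.v • (Omega * F₁))
  | F₂_mul_Psi (a : k) : TaftDualRel (F₂ * Psi a) (Psi a * F₂)
  | F₁_mul_Psi (a : k) : TaftDualRel (F₁ * Psi a) (Psi a * F₁)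
  | F₁_mul_F₂ : TaftDualRel (F₁ * F₂) (F₂ * F₁)

/-- The algebra generated by `Ψ_λ`, `Ω`, `F₁`, `F₂` subject to the relations above. -/
def TaftDual : Type _ := RingQuot (TaftDualRel P)

namespace TaftDual

instance : Ring (TaftDual P) := inferInstanceAs (Ring (RingQuot (TaftDualRel P)))

instance instAlgebra : Algebra k (TaftDual P) :=
  inferInstanceAs (Algebra k (RingQuot (TaftDualRel P)))

/-- The quotient map from the free algebra. -/
def mk : FreeAlgebra k (TaftDualGen k) →ₐ[k] TaftDual P := RingQuot.mkAlgHom k (TaftDualRel P)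

def Psi (lam : k) : TaftDual P := mk P (TaftDualFree.Psi lam)

def Omega : TaftDual P := mk P TaftDualFree.Omega

def F₁ : TaftDual P := mk P TaftDualFree.F₁

def F₂ : TaftDual P := mk P TaftDualFree.F₂

/-- The divided power `F₁^[i] = F₁ ^ i / i!_{ξ ^ v}`, used for `1 ≤ i ≤ m - 1`. -/
def F₁div (i : ℕ) : TaftDual P := (qFactorial (P.ξ ^ P.v) i)⁻¹ • F₁ P ^ i

/-- `ς_c = (m / n) ∑_{0 ≤ i < n / m} ξ ^ (- i m c) Ω ^ (i m)`. -/
def varsigma (c : ℕ) : TaftDual P :=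
  ((P.m : k) / (P.n : k)) •
    ∑ i ∈ Finset.range (P.n / P.m), (P.ξ⁻¹) ^ (i * P.m * c) • Omega P ^ (i * P.m)

/-- `∑_{1 ≤ i ≤ m - 1} F₁^[i] ⊗ Ω ^ i F₁^[m - i]`. -/
def crossTerm : TaftDual P ⊗[k] TaftDual P :=
  ∑ i ∈ Finset.Ico 1 P.m, F₁div P i ⊗ₜ[k] (Omega P ^ i * F₁div P (P.m - i))

variable {P}

/-- The comultiplication, counit and antipode of `M` take the prescribed values on the
generators. -/
structure HasStandardFormulas (M : HopfStructure k (TaftDual P)) : Prop where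
  comul_Omega : M.comul (Omega P) = Omega P ⊗ₜ[k] Omega P
  comul_F₁ : M.comul (F₁ P) = 1 ⊗ₜ[k] F₁ P + F₁ P ⊗ₜ[k] Omega P
  comul_F₂ : M.comul (F₂ P) =
    1 ⊗ₜ[k] F₂ P + F₂ P ⊗ₜ[k] (Omega P ^ P.m) + crossTerm P
  comul_Psi (lam : k) : M.comul (Psi P lam) =
    ∑ c ∈ Finset.range (P.n / P.m),
      (Psi P (lam * P.ξ ^ (P.m * c)) ⊗ₜ[k] (Psi P lam * varsigma P c)) *
        ((1 ⊗ₜ[k] 1) + lam • crossTerm P)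
  counit_Omega : M.counit (Omega P) = 1
  counit_Psi (lam : k) : M.counit (Psi P lam) = 1
  counit_F₁ : M.counit (F₁ P) = 0
  counit_F₂ : M.counit (F₂ P) = 0
  antipode_Omega : M.antipode (Omega P) = Omega P ^ (P.n - 1)
  antipode_F₁ : M.antipode (F₁ P) = -((P.ξ⁻¹) ^ P.v • (Omega P ^ (P.n - 1) * F₁ P))
  antipode_F₂ : M.antipode (F₂ P) = -(Omega P ^ (P.n - P.m) * F₂ P)
  antipode_Psi (lam : k) : M.antipode (Psi P lam) =
    ∑ c ∈ Finset.range (P.n / P.m), Psi P (-lam * (P.ξ⁻¹) ^ (P.m * c)) * varsigma P c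

end TaftDual

end TaftDual

end

/-!
Write `H` for the Taft algebra and `q = ξ ^ v`, a primitive `m`-th root of unity. The proof
computes `H°` through one family of elements of `H`. As `Δ(x)` is a sum of two `q`-commuting
elements, the `q`-binomial theorem shows that `x ^ m` is primitive, and hence that the divided
monomials `y(L, r) = x ^ (m L + r) / (L! r!_q)`, `r < m`, satisfy
`Δ(g ^ a y(L, r)) = ∑ g ^ a y(I, i) ⊗ g ^ (a + v i) y(J, j)`, the sum being over `I + J = L` and
`i + j = r` (`Taft.comul_divPow`).

Say that a functional has symbol `(χ, i, p)`, with `p` a power series, if it takes the value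
`χ a * coeff L p` at `g ^ a y(L, i)` and vanishes at `g ^ a y(L, r)` for the other `r < m`
(`Taft.HasSymbol`). By the formula above, symbols multiply like monomials: functions of `a`
multiply up to a shift, the indices `i` add (the product being `0` once they reach `m`), and the
power series multiply (`Taft.HasSymbol.mul`). The symbols of `ψ_λ`, `ω`, `E₁`, `E₂` are
`(1, 0, exp (λ X))`, `(ξ ^ a, 0, 1)`, `(1, 1, 1)`, `(1, 0, X)` (except that `E₁ = 0` if `m = 1`),
so the relations of `TaftDual` hold in `H°`, which gives an algebra homomorphism `Taft.theta`,
under which the monomial `Ψ_λ Ω ^ s F₁ ^ i F₂ ^ j` goes to the functional with symbol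
`(ξ ^ (s a), i, exp (λ X) X ^ j)`.

Under `X ^ L ↦ L! * coeff L p`, the series `exp (λ X) X ^ j` becomes the functional "`j`-th
derivative at `λ`" on `k[X]` (`polyDual_expMonomial`). These functionals are linearly independent
(`linearIndependent_expMonomial`), and over an algebraically closed field of characteristic `0`
they span the functionals that vanish on a nonzero ideal (`exists_polyDual_eq`). Together with the
orthogonality of the characters `a ↦ ξ ^ (s a)`, independence yields that `theta` is injective. An
element of `H°` vanishes on an ideal containing `p(x ^ m)` for some nonzero polynomial `p`, so its
values at `g ^ a x ^ (m L + r)`, as functions of `L`, are of the spanned form; hence `theta` is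
surjective.

The Hopf structure of `H°` is then transported along `theta`, and the formulas for the
comultiplication and the antipode become identities between functionals, which are checked on the
monomials `g ^ a x ^ l`. For the antipode the sign comes from `S(x ^ m) = - x ^ m`.
-/

noncomputable section

/-! ### Gaussian binomial coefficients -/

section GaussBinom

variable {k : Type*} [Field k]

/-- The Gaussian binomial coefficient `(l choose i)_q`, defined by the `q`-Pascal rule. -/
def gaussBinom (q : k) : ℕ → ℕ → k
  | _, 0 => 1
  | 0, _ + 1 => 0
  | l + 1, i + 1 => gaussBinom q l i + q ^ (i + 1) * gaussBinom q l (i + 1)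

theorem gaussBinom_zero_right (q : k) (l : ℕ) : gaussBinom q l 0 = 1 := by
  cases l <;> rfl

theorem gaussBinom_succ_succ (q : k) (l i : ℕ) : gaussBinom q (l + 1) (i + 1) =
    gaussBinom q l i + q ^ (i + 1) * gaussBinom q l (i + 1) := rfl

theorem gaussBinom_eq_zero (q : k) {l i : ℕ} (h : l < i) : gaussBinom q l i = 0 := by
  induction l generalizing i with
  | zero => obtain ⟨i, rfl⟩ := Nat.exists_eq_succ_of_ne_zero h.ne'; rfl
  | succ l ih =>
    obtain ⟨i, rfl⟩ := Nat.exists_eq_succ_of_ne_zero (Nat.ne_zero_of_lt h)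
    rw [Nat.succ_eq_add_one, gaussBinom_succ_succ, ih (by lia), ih (by lia)]
    simp

theorem qFactorial_zero (q : k) : qFactorial q 0 = 1 := by simp [qFactorial]

theorem qFactorial_one (q : k) : qFactorial q 1 = 1 := by simp [qFactorial]

theorem qFactorial_succ (q : k) (l : ℕ) :
    qFactorial q (l + 1) = qFactorial q l * ∑ t ∈ Finset.range (l + 1), q ^ t :=
  Finset.prod_Icc_succ_top (by lia) _

theorem gaussBinom_mul_qFactorial (q : k) (i j : ℕ) :
    gaussBinom q (i + j) i * (qFactorial q i * qFactorial q j) = qFactorial q (i + j) := by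
  induction hl : i + j generalizing i j with
  | zero =>
    obtain ⟨rfl, rfl⟩ : i = 0 ∧ j = 0 := by lia
    simp [gaussBinom_zero_right, qFactorial_zero]
  | succ l ih =>
    rcases i with _ | i
    · obtain rfl : j = l + 1 := by lia
      simp [gaussBinom_zero_right, qFactorial_zero]
    have h1 := ih i j (by lia)
    rw [gaussBinom_succ_succ, qFactorial_succ q i, qFactorial_succ q l]
    rcases j with _ | j
    · obtain rfl : l = i := by lia
      rw [gaussBinom_eq_zero q (Nat.lt_succ_self l)]
      linear_combination (∑ t ∈ Finset.range (l + 1), q ^ t) * h1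
    · have h2 := ih (i + 1) j (by lia)
      rw [qFactorial_succ q i] at h2
      have h3 : ∑ t ∈ Finset.range (l + 1), q ^ t = ∑ t ∈ Finset.range (i + 1), q ^ t +
          q ^ (i + 1) * ∑ t ∈ Finset.range (j + 1), q ^ t := by
        rw [← hl, Finset.sum_range_add, Finset.mul_sum]
        simp only [pow_add]
      rw [h3]
      linear_combination (∑ t ∈ Finset.range (i + 1), q ^ t) * h1 +
        q ^ (i + 1) * (∑ t ∈ Finset.range (j + 1), q ^ t) * h2 +
        q ^ (i + 1) * gaussBinom q l (i + 1) *
          (qFactorial q i * ∑ t ∈ Finset.range (i + 1), q ^ t) * qFactorial_succ q j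

/-- The `q`-binomial theorem. -/
theorem add_pow_of_mul_eq_smul_mul {R : Type*} [Ring R] [Algebra k R] {q : k} {a b : R}
    (h : a * b = q • (b * a)) (l : ℕ) :
    (a + b) ^ l = ∑ p ∈ Finset.HasAntidiagonal.antidiagonal l,
      gaussBinom q l p.1 • (b ^ p.1 * a ^ p.2) := by
  have hp : ∀ i, a * b ^ i = q ^ i • (b ^ i * a) := by
    intro i
    induction i with
    | zero => simp
    | succ i ih => rw [pow_succ, ← mul_assoc, ih, smul_mul_assoc, mul_assoc, h, mul_smul_comm,
        smul_smul, ← pow_succ, ← mul_assoc]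
  induction l with
  | zero => simp [gaussBinom_zero_right]
  | succ l ih =>
    have h1 : ∑ p ∈ Finset.HasAntidiagonal.antidiagonal l, (q ^ p.1 * gaussBinom q l p.1) •
        (b ^ p.1 * a ^ (p.2 + 1)) = a ^ (l + 1) + ∑ p ∈ Finset.HasAntidiagonal.antidiagonal l,
          (q ^ (p.1 + 1) * gaussBinom q l (p.1 + 1)) • (b ^ (p.1 + 1) * a ^ p.2) := by
      have e1 := Finset.Nat.sum_antidiagonal_succ (n := l) (f := fun p : ℕ × ℕ =>
        (q ^ p.1 * gaussBinom q l p.1) • (b ^ p.1 * a ^ p.2))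
      rw [Finset.Nat.sum_antidiagonal_succ', gaussBinom_eq_zero q (Nat.lt_succ_self l),
        gaussBinom_zero_right] at e1
      simpa using e1
    rw [pow_succ', ih, Finset.Nat.sum_antidiagonal_succ, gaussBinom_zero_right, one_smul, pow_zero,
      one_mul, add_mul, Finset.mul_sum, Finset.mul_sum]
    simp only [gaussBinom_succ_succ, add_smul, Finset.sum_add_distrib]
    rw [add_left_comm, ← h1, add_comm]
    congr 1
    · refine Finset.sum_congr rfl fun p _ => ?_
      rw [mul_smul_comm, ← mul_assoc, ← pow_succ']
    · refine Finset.sum_congr rfl fun p _ => ?_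
      rw [mul_smul_comm, ← mul_assoc, hp, smul_mul_assoc, mul_assoc, ← pow_succ', smul_smul,
        mul_comm]

variable {q : k} {m : ℕ}

theorem geom_sum_ne_zero_of_lt [CharZero k] (hq : IsPrimitiveRoot q m) {l : ℕ} (h0 : l ≠ 0)
    (hl : l < m) :
    ∑ t ∈ Finset.range l, q ^ t ≠ 0 := by
  intro h
  have h1 := geom_sum_mul q l
  rw [h, zero_mul, eq_comm, sub_eq_zero] at h1
  exact hq.pow_ne_one_of_pos_of_lt h0 hl h1

theorem qFactorial_ne_zero [CharZero k] (hq : IsPrimitiveRoot q m) {l : ℕ} (hl : l < m) :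
    qFactorial q l ≠ 0 :=
  Finset.prod_ne_zero_iff.2 fun i hi => by
    rw [Finset.mem_Icc] at hi
    exact geom_sum_ne_zero_of_lt hq (by lia) (by lia)

theorem gaussBinom_eq_zero_of_primitive [CharZero k] (hq : IsPrimitiveRoot q m) {i : ℕ} (h0 : i ≠ 0)
    (hi : i < m) :
    gaussBinom q m i = 0 := by
  obtain ⟨j, rfl⟩ := Nat.exists_eq_add_of_le hi.le
  have h := gaussBinom_mul_qFactorial q i j
  obtain ⟨l, hl⟩ : ∃ l, i + j = l + 1 := ⟨i + j - 1, by lia⟩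
  have h2 : qFactorial q (i + j) = 0 := by
    rw [hl, qFactorial_succ, ← hl, hq.geom_sum_eq_zero (by lia), mul_zero]
  rw [h2] at h
  exact (mul_eq_zero.1 h).resolve_right
    (mul_ne_zero (qFactorial_ne_zero hq hi) (qFactorial_ne_zero hq (by lia)))

/-- At a primitive `m`-th root of unity all inner Gaussian binomials `(m choose i)_q` vanish. -/
theorem add_pow_of_primitive [CharZero k] (hq : IsPrimitiveRoot q m) {R : Type*} [Ring R]
    [Algebra k R] {a b : R}
    (h : a * b = q • (b * a)) (hm : 0 < m) : (a + b) ^ m = a ^ m + b ^ m := by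
  obtain ⟨l, rfl⟩ : ∃ l, m = l + 1 := ⟨m - 1, by lia⟩
  rw [add_pow_of_mul_eq_smul_mul h, Finset.Nat.sum_antidiagonal_succ, gaussBinom_zero_right]
  congr 1
  · simp
  · rw [Finset.sum_eq_single_of_mem (l, 0) (by simp)]
    · have h1 := gaussBinom_mul_qFactorial q (l + 1) 0
      have h2 : gaussBinom q (l + 1) (l + 1) = 1 := by
        clear h1
        induction l + 1 with
        | zero => rfl
        | succ n ih => simp [gaussBinom_succ_succ, ih, gaussBinom_eq_zero q (Nat.lt_succ_self n)]
      simp [h2]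
    · rintro ⟨i, j⟩ hij hne
      rw [Finset.HasAntidiagonal.mem_antidiagonal] at hij
      simp only at hij ⊢
      have : i ≠ l := by
        rintro rfl
        exact hne (by simp; lia)
      rw [gaussBinom_eq_zero_of_primitive hq (by lia) (by lia), zero_smul]

/-- The `q`-binomial theorem in terms of divided powers. -/
theorem smul_add_pow_of_lt [CharZero k] (hq : IsPrimitiveRoot q m) {R : Type*} [Ring R]
    [Algebra k R] {a b : R}
    (h : a * b = q • (b * a)) {r : ℕ} (hr : r < m) :
    (qFactorial q r)⁻¹ • (a + b) ^ r = ∑ p ∈ Finset.HasAntidiagonal.antidiagonal r,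
      ((qFactorial q p.1)⁻¹ • b ^ p.1) * ((qFactorial q p.2)⁻¹ • a ^ p.2) := by
  rw [add_pow_of_mul_eq_smul_mul h, Finset.smul_sum]
  refine Finset.sum_congr rfl fun p hp => ?_
  rw [Finset.HasAntidiagonal.mem_antidiagonal] at hp
  have h1 := qFactorial_ne_zero hq (l := p.1) (by lia)
  have h2 := qFactorial_ne_zero hq (l := p.2) (by lia)
  have h3 := qFactorial_ne_zero hq hr
  have h4 := gaussBinom_mul_qFactorial q p.1 p.2
  rw [hp] at h4
  rw [smul_mul_smul_comm, smul_smul]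
  congr 1
  field_simp
  linear_combination h4

end GaussBinom

/-- The binomial theorem in terms of divided powers. -/
theorem Commute.smul_add_pow {k R : Type*} [Field k] [CharZero k] [Ring R] [Algebra k R] {a b : R}
    (h : Commute a b) (n : ℕ) : ((n.factorial : k))⁻¹ • (a + b) ^ n =
      ∑ p ∈ Finset.HasAntidiagonal.antidiagonal n,
        ((p.1.factorial : k)⁻¹ • a ^ p.1) * ((p.2.factorial : k)⁻¹ • b ^ p.2) := by
  rw [h.add_pow', Finset.smul_sum]
  refine Finset.sum_congr rfl fun p hp => ?_
  rw [Finset.HasAntidiagonal.mem_antidiagonal] at hp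
  have h1 : (p.1.factorial : k) ≠ 0 := Nat.cast_ne_zero.2 p.1.factorial_ne_zero
  have h2 : (p.2.factorial : k) ≠ 0 := Nat.cast_ne_zero.2 p.2.factorial_ne_zero
  have h3 : (n.factorial : k) ≠ 0 := Nat.cast_ne_zero.2 n.factorial_ne_zero
  have h4 : ((n.choose p.1 : ℕ) : k) * p.1.factorial * p.2.factorial = n.factorial := by
    rw [show p.2 = n - p.1 by lia]
    exact_mod_cast Nat.choose_mul_factorial_mul_factorial (by lia)
  rw [smul_mul_smul_comm, ← Nat.cast_smul_eq_nsmul k, smul_smul]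
  congr 1
  field_simp
  linear_combination h4

/-! ### Normalized monomials of the Taft algebra -/

/-- Orthogonality of the characters of a cyclic group. -/
theorem IsPrimitiveRoot.sum_pow_pow {k : Type*} [Field k] {ζ : k} {N : ℕ}
    (hζ : IsPrimitiveRoot ζ N) (l : ℕ) :
    ∑ i ∈ Finset.range N, (ζ ^ l) ^ i = if N ∣ l then (N : k) else 0 := by
  split_ifs with h
  · simp [(hζ.pow_eq_one_iff_dvd l).2 h]
  · have h1 := mul_geom_sum (ζ ^ l) N
    rw [pow_right_comm, hζ.pow_eq_one, one_pow, sub_self, mul_eq_zero, sub_eq_zero] at h1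
    exact h1.resolve_left fun h2 => h ((hζ.pow_eq_one_iff_dvd l).1 h2)

theorem IsPrimitiveRoot.sum_inv_pow_mul_pow {k : Type*} [Field k] {ζ : k} {N : ℕ} (hN : 0 < N)
    (hζ : IsPrimitiveRoot ζ N) (c a : ℕ) :
    ∑ i ∈ Finset.range N, (ζ⁻¹) ^ (i * c) * ζ ^ (i * a) = if a ≡ c [MOD N] then (N : k) else 0 := by
  have h1 : ζ⁻¹ = ζ ^ (N - 1) := by
    refine inv_eq_of_mul_eq_one_right ?_
    rw [← pow_succ', Nat.sub_add_cancel hN, hζ.pow_eq_one]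
  have h2 : N ∣ (N - 1) * c + a ↔ a ≡ c [MOD N] := by
    rw [Nat.ModEq.comm, Nat.modEq_iff_dvd, ← Int.natCast_dvd_natCast]
    push_cast [Nat.cast_sub hN]
    rw [show ((N : ℤ) - 1) * c + a = N * c + (a - c) by ring, dvd_add_right (dvd_mul_right _ _)]
  simp only [← h2]
  rw [← hζ.sum_pow_pow]
  refine Finset.sum_congr rfl fun i _ => ?_
  rw [h1, ← pow_mul, ← pow_add, ← pow_mul]
  congr 1
  ring

/-- A subset of an algebra spans it if its span contains `1` and is stable under left
multiplication by generators. -/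
theorem Submodule.span_eq_top_of_forall_mul_mem {k A : Type*} [CommRing k] [Ring A] [Algebra k A]
    {s t : Set A} (hs : Algebra.adjoin k s = ⊤) (h1 : (1 : A) ∈ Submodule.span k t)
    (h : ∀ a ∈ s, ∀ b ∈ t, a * b ∈ Submodule.span k t) : Submodule.span k t = ⊤ := by
  have key : ∀ a ∈ Algebra.adjoin k s, ∀ b ∈ Submodule.span k t, a * b ∈ Submodule.span k t := by
    intro a ha
    induction ha using Algebra.adjoin_induction with
    | mem a ha =>
      intro b hb
      induction hb using Submodule.span_induction with
      | zero => simp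
      | add c d _ _ hc hd => rw [mul_add]; exact add_mem hc hd
      | smul r c _ hc => rw [mul_smul_comm]; exact Submodule.smul_mem _ _ hc
      | mem b hb => exact h a ha b hb
    | algebraMap r =>
      intro b hb
      rw [← Algebra.smul_def]
      exact Submodule.smul_mem _ _ hb
    | add a a' _ _ ha ha' =>
      intro b hb
      rw [add_mul]
      exact add_mem (ha b hb) (ha' b hb)
    | mul a a' _ _ ha ha' =>
      intro b hb
      rw [mul_assoc]
      exact ha _ (ha' _ hb)
  rw [eq_top_iff]
  intro a _
  simpa using key a (by rw [hs]; trivial) 1 h1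

namespace TaftParams

variable {k : Type*} [Field k] (P : TaftParams k)

theorem m_pos : 0 < P.m :=
  Nat.div_pos (Nat.gcd_le_left _ P.n_pos) (Nat.gcd_pos_of_pos_left _ P.n_pos)

theorem m_dvd : P.m ∣ P.n := Nat.div_dvd_of_dvd (Nat.gcd_dvd_left _ _)

theorem m_le : P.m ≤ P.n := Nat.le_of_dvd P.n_pos P.m_dvd

theorem q_primitive : IsPrimitiveRoot (P.ξ ^ P.v) P.m := by
  have h := IsPrimitiveRoot.orderOf (P.ξ ^ P.v)
  have hfin : IsOfFinOrder P.ξ := isOfFinOrder_iff_pow_eq_one.2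
    ⟨P.n, P.n_pos, P.primitive.pow_eq_one⟩
  rwa [hfin.orderOf_pow, ← P.primitive.eq_orderOf] at h

theorem m_eq_one_iff : P.m = 1 ↔ P.v = 0 := by
  have h := P.v_lt
  constructor
  · intro h1
    have h2 : P.n = Nat.gcd P.n P.v := by
      have := Nat.div_mul_cancel (Nat.gcd_dvd_left P.n P.v)
      change P.m * _ = _ at this
      rw [h1, one_mul] at this
      exact this.symm
    exact Nat.eq_zero_of_dvd_of_lt (h2 ▸ Nat.gcd_dvd_right P.n P.v) h
  · intro h1
    rw [m, h1, Nat.gcd_zero_right, Nat.div_self P.n_pos]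

theorem ξ_pow_congr {a b : ℕ} (h : a ≡ b [MOD P.n]) : P.ξ ^ a = P.ξ ^ b := by
  have hmod : ∀ c, P.ξ ^ (c % P.n) = P.ξ ^ c := fun c => by
    conv_rhs => rw [← Nat.mod_add_div c P.n, pow_add, pow_mul, P.primitive.pow_eq_one, one_pow,
      mul_one]
  rw [← hmod a, ← hmod b, h]

theorem ξ_pow_v_mul_m : P.ξ ^ (P.v * P.m) = 1 := by
  rw [pow_mul, P.q_primitive.pow_eq_one]

end TaftParams

namespace Taft

variable {k : Type*} [Field k] {P : TaftParams k}

theorem x_pow_mul_g_pow (l i : ℕ) :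
    x P ^ l * g P ^ i = P.ξ ^ (l * i) • (g P ^ i * x P ^ l) := by
  induction l with
  | zero => simp
  | succ l ih =>
    rw [pow_succ, mul_assoc, x_mul_g_pow, mul_smul_comm, ← mul_assoc, ih, smul_mul_assoc, smul_smul,
      mul_assoc, ← pow_add, Nat.succ_mul, add_comm]

theorem comul_g : Coalgebra.comul (R := k) (g P) = g P ⊗ₜ[k] g P := by
  change comul (g P) = _
  simp [comul]

theorem comul_x : Coalgebra.comul (R := k) (x P) = 1 ⊗ₜ[k] x P + x P ⊗ₜ[k] (g P ^ P.v) := by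
  change comul (x P) = _
  simp [comul]

theorem one_tmul_x_mul : ((1 : Taft P) ⊗ₜ[k] x P) * (x P ⊗ₜ[k] (g P ^ P.v)) =
    P.ξ ^ P.v • ((x P ⊗ₜ[k] (g P ^ P.v)) * ((1 : Taft P) ⊗ₜ[k] x P)) := by
  simp [x_mul_g_pow]

theorem g_pow_mod (a : ℕ) : g P ^ (a % P.n) = g P ^ a := by
  conv_rhs => rw [← Nat.mod_add_div a P.n, pow_add, pow_mul, g_pow_n, one_pow, mul_one]

theorem g_pow_v_mul_m : g P ^ (P.v * P.m) = 1 := by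
  have h : P.n ∣ P.v * P.m := P.primitive.dvd_of_pow_eq_one _ P.ξ_pow_v_mul_m
  obtain ⟨c, hc⟩ := h
  rw [hc, pow_mul, g_pow_n, one_pow]

/-- Since `Δ(x) = 1 ⊗ x + x ⊗ g ^ v` is a sum of two `ξ ^ v`-commuting elements, `x ^ m` is
primitive. -/
theorem comul_x_pow_m [CharZero k] : Coalgebra.comul (R := k) (x P ^ P.m) =
    1 ⊗ₜ[k] (x P ^ P.m) + (x P ^ P.m) ⊗ₜ[k] 1 := by
  rw [Bialgebra.comul_pow, comul_x, add_pow_of_primitive P.q_primitive one_tmul_x_mul P.m_pos]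
  simp [Algebra.TensorProduct.tmul_pow, ← pow_mul, g_pow_v_mul_m]

/-- The divided monomial `x ^ (m L + r) / (L! r!_q)` with `q = ξ ^ v`. Only the case `r < m` is
meaningful: for `r ≥ m ≥ 2` the factorial `r!_q` vanishes, and so does this element. -/
def divPow (P : TaftParams k) (L r : ℕ) : Taft P :=
  ((L.factorial : k)⁻¹ • (x P ^ P.m) ^ L) * ((qFactorial (P.ξ ^ P.v) r)⁻¹ • x P ^ r)

theorem x_pow_eq_smul_divPow [CharZero k] {L r : ℕ} (hr : r < P.m) :
    x P ^ (P.m * L + r) = ((L.factorial : k) * qFactorial (P.ξ ^ P.v) r) • divPow P L r := by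
  have h1 : (L.factorial : k) ≠ 0 := Nat.cast_ne_zero.2 L.factorial_ne_zero
  have h2 := qFactorial_ne_zero P.q_primitive hr
  rw [divPow, smul_mul_smul_comm, smul_smul, pow_add, pow_mul, ← mul_inv,
    mul_inv_cancel₀ (mul_ne_zero h1 h2), one_smul]

/-- In terms of divided monomials the comultiplication has no coefficients. -/
theorem comul_divPow [CharZero k] {r : ℕ} (hr : r < P.m) (a L : ℕ) :
    Coalgebra.comul (R := k) (g P ^ a * divPow P L r) =
      ∑ p ∈ Finset.HasAntidiagonal.antidiagonal L, ∑ s ∈ Finset.HasAntidiagonal.antidiagonal r,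
        (g P ^ a * divPow P p.1 s.1) ⊗ₜ[k] (g P ^ (a + P.v * s.1) * divPow P p.2 s.2) := by
  have hc : Commute ((1 : Taft P) ⊗ₜ[k] (x P ^ P.m)) ((x P ^ P.m) ⊗ₜ[k] (1 : Taft P)) := by
    simp [Commute, SemiconjBy]
  rw [Bialgebra.comul_mul, Bialgebra.comul_pow, comul_g, divPow, Bialgebra.comul_mul, map_smul,
    map_smul, Bialgebra.comul_pow, Bialgebra.comul_pow (x P) r, comul_x_pow_m, comul_x,
    smul_add_pow_of_lt P.q_primitive one_tmul_x_mul hr, add_comm, hc.symm.smul_add_pow,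
    Finset.sum_mul_sum, Finset.mul_sum]
  refine Finset.sum_congr rfl fun p _ => ?_
  rw [Finset.mul_sum]
  refine Finset.sum_congr rfl fun s _ => ?_
  have h1 : x P ^ (P.m * p.2) * g P ^ (P.v * s.1) =
      g P ^ (P.v * s.1) * x P ^ (P.m * p.2) := by
    rw [x_pow_mul_g_pow, show P.m * p.2 * (P.v * s.1) = P.v * P.m * (p.2 * s.1) by ring,
      pow_mul, P.ξ_pow_v_mul_m, one_pow, one_smul]
  simp only [Algebra.TensorProduct.tmul_pow, one_pow, Algebra.TensorProduct.tmul_mul_tmul,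
    TensorProduct.smul_tmul', TensorProduct.tmul_smul, divPow, mul_smul_comm,
    smul_mul_assoc, smul_smul, mul_one, one_mul, ← pow_mul]
  congr 1
  · congr 1
    ring
  · simp only [pow_add, mul_assoc]
    simp only [← mul_assoc, h1]

/-- The monomials `g ^ a x ^ l` span the Taft algebra. -/
theorem linearMap_ext {V : Type*} [AddCommGroup V] [Module k V] {φ ψ : Taft P →ₗ[k] V}
    (h : ∀ a l, φ (g P ^ a * x P ^ l) = ψ (g P ^ a * x P ^ l)) : φ = ψ := by
  have htop : Submodule.span k (Set.range fun p : ℕ × ℕ => g P ^ p.1 * x P ^ p.2) = ⊤ := by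
    refine Submodule.span_eq_top_of_forall_mul_mem adjoin_eq_top
      (Submodule.subset_span ⟨(0, 0), by simp⟩) ?_
    rintro _ (rfl | rfl) _ ⟨p, rfl⟩
    · exact Submodule.subset_span ⟨(p.1 + 1, p.2), by simp [pow_succ', mul_assoc]⟩
    · simp only
      rw [← mul_assoc, x_mul_g_pow, smul_mul_assoc, mul_assoc, ← pow_succ']
      exact Submodule.smul_mem _ _ (Submodule.subset_span ⟨(p.1, p.2 + 1), rfl⟩)
  refine LinearMap.ext_on htop ?_
  rintro _ ⟨p, rfl⟩
  exact h _ _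

theorem linearMap_ext_divPow [CharZero k] {V : Type*} [AddCommGroup V] [Module k V]
    {φ ψ : Taft P →ₗ[k] V}
    (h : ∀ a L r, r < P.m → φ (g P ^ a * divPow P L r) = ψ (g P ^ a * divPow P L r)) : φ = ψ := by
  refine linearMap_ext fun a l => ?_
  rw [← Nat.div_add_mod l P.m, x_pow_eq_smul_divPow (Nat.mod_lt _ P.m_pos), mul_smul_comm,
    map_smul, map_smul, h a (l / P.m) (l % P.m) (Nat.mod_lt _ P.m_pos)]

end Taft

/-! ### Symbols of elements of the finite dual -/

namespace Taft

variable {k : Type*} [Field k] {P : TaftParams k}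

theorem counit_g : Coalgebra.counit (R := k) (g P) = 1 := by
  change counit (g P) = 1
  simp [counit]

theorem counit_x : Coalgebra.counit (R := k) (x P) = 0 := by
  change counit (x P) = 0
  simp [counit]

theorem one_apply (j l : ℕ) : (1 : FiniteDual k (Taft P)).toDual (g P ^ j * x P ^ l) =
    if l = 0 then 1 else 0 := by
  simp [counit_g, counit_x, zero_pow_eq]

/-- The functional `f` sends `g ^ a x ^ (m L + r) / (L! r!_q)` to `χ a * coeff L p` if `r = i`, and
to `0` for the other `r < m`. Thus `p` is an exponential generating function of the values at
`x ^ (m L + i)`. The condition is imposed for all `a`, not only for `a < n`. -/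
def HasSymbol (f : FiniteDual k (Taft P)) (χ : ℕ → k) (i : ℕ) (p : PowerSeries k) : Prop :=
  ∀ a L r, r < P.m → f.toDual (g P ^ a * divPow P L r) =
    if r = i then χ a * PowerSeries.coeff L p else 0

theorem finiteDual_ext [CharZero k] {f f' : FiniteDual k (Taft P)}
    (h : ∀ a L r, r < P.m → f.toDual (g P ^ a * divPow P L r) =
      f'.toDual (g P ^ a * divPow P L r)) : f = f' :=
  FiniteDual.toDual_injective (linearMap_ext_divPow h)

namespace HasSymbol

variable {f f' : FiniteDual k (Taft P)} {χ χ' : ℕ → k} {i i' : ℕ} {p p' : PowerSeries k}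

theorem unique [CharZero k] (h : HasSymbol f χ i p) (h' : HasSymbol f' χ i p) : f = f' :=
  finiteDual_ext fun a L r hr => by rw [h a L r hr, h' a L r hr]

theorem apply_x_pow [CharZero k] (h : HasSymbol f χ i p) (a L : ℕ) {r : ℕ} (hr : r < P.m) :
    f.toDual (g P ^ a * x P ^ (P.m * L + r)) =
      if r = i then L.factorial * qFactorial (P.ξ ^ P.v) r * (χ a * PowerSeries.coeff L p)
      else 0 := by
  rw [x_pow_eq_smul_divPow hr, mul_smul_comm, map_smul, h a L r hr, smul_eq_mul, mul_ite, mul_zero]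

theorem smul (h : HasSymbol f χ i p) (c : k) : HasSymbol (c • f) χ i (c • p) := by
  intro a L r hr
  rw [map_smul, LinearMap.smul_apply, h a L r hr]
  split_ifs <;> simp [mul_left_comm]

theorem one : HasSymbol (1 : FiniteDual k (Taft P)) (fun _ => 1) 0 1 := by
  intro a L r hr
  simp only [FiniteDual.toDual_one, divPow, Bialgebra.counit_mul, Bialgebra.counit_pow, map_smul,
    counit_g, counit_x, one_pow, one_mul, zero_pow P.m_pos.ne', PowerSeries.coeff_one]
  rcases L with _ | L <;> rcases r with _ | r <;> simp [qFactorial_zero]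

theorem apply_mul [CharZero k] (h : HasSymbol f χ i p) (h' : HasSymbol f' χ' i' p') (a L : ℕ)
    {r : ℕ} (hr : r < P.m) : (f * f').toDual (g P ^ a * divPow P L r) =
      if r = i + i' then χ a * χ' (a + P.v * i) * PowerSeries.coeff L (p * p') else 0 := by
  rw [FiniteDual.toDual_mul, comul_divPow hr, map_sum, map_sum]
  have key : ∀ u ∈ Finset.HasAntidiagonal.antidiagonal L,
      (LinearMap.mul' k k) ((TensorProduct.map f.toDual f'.toDual)
        (∑ s ∈ Finset.HasAntidiagonal.antidiagonal r,
          (g P ^ a * divPow P u.1 s.1) ⊗ₜ[k] (g P ^ (a + P.v * s.1) * divPow P u.2 s.2))) =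
      if r = i + i' then χ a * χ' (a + P.v * i) *
        (PowerSeries.coeff u.1 p * PowerSeries.coeff u.2 p') else 0 := by
    intro u _
    have e : ∀ s ∈ Finset.HasAntidiagonal.antidiagonal r, (LinearMap.mul' k k)
        ((TensorProduct.map f.toDual f'.toDual)
          ((g P ^ a * divPow P u.1 s.1) ⊗ₜ[k] (g P ^ (a + P.v * s.1) * divPow P u.2 s.2))) =
        if s = (i, i') then χ a * χ' (a + P.v * i) *
          (PowerSeries.coeff u.1 p * PowerSeries.coeff u.2 p') else 0 := by
      rintro ⟨s, s'⟩ hs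
      rw [Finset.HasAntidiagonal.mem_antidiagonal] at hs
      simp only at hs
      rw [TensorProduct.map_tmul, LinearMap.mul'_apply, h a _ _ (by lia), h' _ _ _ (by lia)]
      by_cases h1 : s = i <;> by_cases h2 : s' = i' <;> simp [h1, h2]
      ring
    rw [map_sum, map_sum, Finset.sum_congr rfl e, Finset.sum_ite_eq']
    simp only [Finset.HasAntidiagonal.mem_antidiagonal, eq_comm]
  rw [Finset.sum_congr rfl key, PowerSeries.coeff_mul, Finset.mul_sum]
  split_ifs <;> simp

/-- If `m ≤ i + i'`, this says that the product is zero, as in `HasSymbol.mul_eq_zero`. -/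
theorem mul [CharZero k] (h : HasSymbol f χ i p) (h' : HasSymbol f' χ' i' p') :
    HasSymbol (f * f') (fun a => χ a * χ' (a + P.v * i)) (i + i') (p * p') :=
  fun a L _ hr => h.apply_mul h' a L hr

theorem mul_eq_zero [CharZero k] (h : HasSymbol f χ i p) (h' : HasSymbol f' χ' i' p')
    (hi : P.m ≤ i + i') :
    f * f' = 0 :=
  finiteDual_ext fun a L r hr => by
    rw [h.apply_mul h' a L hr, if_neg (by lia), map_zero, LinearMap.zero_apply]

end HasSymbol

/-! ### The functionals generating the finite dual -/

/-- The matrix coefficient `a ↦ β (φ a v)` of a finite dimensional representation `φ`. -/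
def matrixCoeff {V : Type*} [AddCommGroup V] [Module k V] [Module.Finite k V]
    (φ : Taft P →ₐ[k] Module.End k V) (v : V) (β : V →ₗ[k] k) : FiniteDual k (Taft P) :=
  ⟨WithConv.toConv ((β ∘ₗ LinearMap.applyₗ v) ∘ₗ φ.toLinearMap), VanishesOnCofinite.of_algHom φ _⟩

theorem toDual_matrixCoeff {V : Type*} [AddCommGroup V] [Module k V] [Module.Finite k V]
    (φ : Taft P →ₐ[k] Module.End k V) (v : V) (β : V →ₗ[k] k) (a : Taft P) :
    (matrixCoeff φ v β).toDual a = β (φ a v) := rfl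

/-- For `μ ^ m = λ` there is an `n`-dimensional representation in which `x` acts as the diagonal
matrix with entries `μ ξ ^ t` and `g` as the cyclic shift. In its matrix coefficient at the vector
`m⁻¹ ∑_{t < m} e_{t n / m}`, averaging over `m`-th roots of unity cancels `x ^ l` unless `m ∣ l`. -/
theorem exists_toDual_eq_pow [CharZero k] [IsAlgClosed k] (P : TaftParams k) (lam : k) :
    ∃ f : FiniteDual k (Taft P), ∀ j l : ℕ, f.toDual (g P ^ j * x P ^ l) =
      if P.m ∣ l then lam ^ (l / P.m) else 0 := by
  have : NeZero P.n := ⟨P.n_pos.ne'⟩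
  obtain ⟨μ, hμ⟩ := IsAlgClosed.exists_pow_nat_eq lam P.m_pos
  let G : Module.End k (ZMod P.n → k) := LinearMap.funLeft k k (fun t => t - 1)
  let X : Module.End k (ZMod P.n → k) := LinearMap.mulLeft k (fun t => μ * P.ξ ^ t.val)
  have hG : ∀ (a : ℕ) (u : ZMod P.n → k) t, (G ^ a) u t = u (t - a) := by
    intro a
    induction a with
    | zero => simp
    | succ a ih =>
      intro u t
      rw [pow_succ, Module.End.mul_apply, ih]
      simp [G, LinearMap.funLeft_apply, sub_sub]
  have hX : ∀ (l : ℕ) (u : ZMod P.n → k) t, (X ^ l) u t = μ ^ l * P.ξ ^ (t.val * l) * u t := by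
    intro l
    induction l with
    | zero => simp
    | succ l ih =>
      intro u t
      rw [pow_succ, Module.End.mul_apply, ih]
      simp [X]
      ring
  let φ : Taft P →ₐ[k] Module.End k (ZMod P.n → k) := lift G X
    (by
      ext u t
      simp [hG])
    (by
      refine LinearMap.ext fun u => funext fun t => ?_
      have : P.ξ ^ t.val = P.ξ * P.ξ ^ (t - 1).val := by
        rw [← pow_succ']
        exact P.ξ_pow_congr ((ZMod.natCast_eq_natCast_iff _ _ _).1 (by simp))
      simp only [G, X, Module.End.mul_apply, LinearMap.smul_apply, Pi.smul_apply,
        LinearMap.funLeft_apply, LinearMap.mulLeft_apply, Pi.mul_apply, smul_eq_mul, this]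
      ring)
  let d := P.n / P.m
  let u : ZMod P.n → k := ∑ t ∈ Finset.range P.m, Pi.single ((t * d : ℕ) : ZMod P.n) ((P.m : k)⁻¹)
  refine ⟨matrixCoeff φ u (∑ t, LinearMap.proj t), fun j l => ?_⟩
  rw [toDual_matrixCoeff, map_mul, map_pow, map_pow, lift_g, lift_x, Module.End.mul_apply]
  simp only [LinearMap.sum_apply, LinearMap.proj_apply, hG, hX]
  have hd : d * P.m = P.n := Nat.div_mul_cancel P.m_dvd
  have hζ : IsPrimitiveRoot (P.ξ ^ d) P.m := P.primitive.pow P.n_pos hd.symm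
  have h1 : ∀ s ∈ Finset.range P.m, ∑ t : ZMod P.n, μ ^ l * P.ξ ^ (t.val * l) *
      (Pi.single ((s * d : ℕ) : ZMod P.n) (P.m : k)⁻¹ : ZMod P.n → k) t =
      μ ^ l * (P.m : k)⁻¹ * ((P.ξ ^ d) ^ l) ^ s := by
    intro s _
    have h2 : P.ξ ^ ((s * d : ℕ) : ZMod P.n).val = P.ξ ^ (s * d) :=
      P.ξ_pow_congr ((ZMod.natCast_eq_natCast_iff _ _ _).1 (by simp))
    simp only [Pi.single_apply, mul_ite, mul_zero, Finset.sum_ite_eq', Finset.mem_univ, if_true,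
      pow_mul _ _ l, h2]
    rw [← pow_mul, ← pow_mul, ← pow_mul]
    ring_nf
  refine ((Equiv.subRight (j : ZMod P.n)).sum_comp
    (fun t => μ ^ l * P.ξ ^ (t.val * l) * u t)).trans ?_
  simp only [u, Finset.sum_apply, Finset.mul_sum]
  rw [Finset.sum_comm, Finset.sum_congr rfl h1, ← Finset.mul_sum, hζ.sum_pow_pow]
  split_ifs with h
  · have hm : (P.m : k) ≠ 0 := Nat.cast_ne_zero.2 P.m_pos.ne'
    obtain ⟨c, rfl⟩ := h
    rw [Nat.mul_div_cancel_left c P.m_pos, ← hμ, ← pow_mul]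
    field_simp
  · simp

/-- The functional is a matrix coefficient of the `(N + 1)`-dimensional representation in which `x` is
a nilpotent Jordan block and `g` is diagonal, with entry `1` at the last vector. -/
theorem exists_toDual_eq_single (P : TaftParams k) (N : ℕ) :
    ∃ f : FiniteDual k (Taft P), ∀ j l : ℕ, f.toDual (g P ^ j * x P ^ l) =
      if l = N then 1 else 0 := by
  let G : Module.End k (Fin (N + 1) → k) := LinearMap.mulLeft k (fun r => P.ξ ^ (N - r))
  let X : Module.End k (Fin (N + 1) → k) :=
    LinearMap.pi fun r => if h : (r : ℕ) = 0 then 0 else LinearMap.proj ⟨r - 1, by lia⟩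
  have hG : ∀ (a : ℕ) (u : Fin (N + 1) → k) t, (G ^ a) u t = P.ξ ^ ((N - t) * a) * u t := by
    intro a
    induction a with
    | zero => simp
    | succ a ih =>
      intro u t
      rw [pow_succ, Module.End.mul_apply, ih]
      simp [G]
      ring
  have hX' : ∀ (u : Fin (N + 1) → k) t, X u t =
      if h : (t : ℕ) = 0 then 0 else u ⟨t - 1, by lia⟩ := by
    intro u t
    simp only [X, LinearMap.pi_apply]
    split_ifs <;> rfl
  have hX : ∀ (l : ℕ) (u : Fin (N + 1) → k) t, (X ^ l) u t =
      if h : l ≤ t then u ⟨t - l, by lia⟩ else 0 := by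
    intro l
    induction l with
    | zero => simp
    | succ l ih =>
      intro u t
      rw [pow_succ, Module.End.mul_apply, ih]
      simp only [hX']
      split_ifs <;> first | rfl | lia
  let φ : Taft P →ₐ[k] Module.End k (Fin (N + 1) → k) := lift G X
    (by
      refine LinearMap.ext fun u => funext fun t => ?_
      rw [hG, mul_comm (N - (t : ℕ)), pow_mul, P.primitive.pow_eq_one]
      simp)
    (by
      refine LinearMap.ext fun u => funext fun t => ?_
      simp only [G, hX', Module.End.mul_apply, LinearMap.smul_apply, Pi.smul_apply,
        LinearMap.mulLeft_apply, Pi.mul_apply, smul_eq_mul]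
      split_ifs with h
      · simp
      · have : N - ((t : ℕ) - 1) = N - t + 1 := by lia
        simp only [this, pow_succ]
        ring)
  refine ⟨matrixCoeff φ (Pi.single 0 1) (LinearMap.proj (Fin.last N)), fun j l => ?_⟩
  rw [toDual_matrixCoeff, map_mul, map_pow, map_pow, lift_g, lift_x, Module.End.mul_apply]
  simp only [LinearMap.proj_apply, hG, hX, Fin.val_last, Nat.sub_self, zero_mul, pow_zero, one_mul]
  by_cases h : l = N
  · subst h
    rw [dif_pos le_rfl, if_pos rfl, show (⟨l - l, by lia⟩ : Fin (l + 1)) = 0 from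
      Fin.ext (Nat.sub_self l), Pi.single_eq_same]
  · by_cases h' : l ≤ N
    · rw [dif_pos h', if_neg h, Pi.single_eq_of_ne]
      intro h1
      have := congrArg Fin.val h1
      simp only [Fin.val_zero] at this
      lia
    · rw [dif_neg h', if_neg h]

/-- The functional `ψ_λ`. -/
def psi [CharZero k] [IsAlgClosed k] (P : TaftParams k) (lam : k) : FiniteDual k (Taft P) :=
  (exists_toDual_eq_pow P lam).choose

/-- The functional `ω`, a character of the Taft algebra. -/
def omega (P : TaftParams k) : FiniteDual k (Taft P) :=
  ⟨WithConv.toConv (lift P.ξ 0 P.primitive.pow_eq_one (by simp) : Taft P →ₐ[k] k).toLinearMap,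
    VanishesOnCofinite.of_algHom _ LinearMap.id⟩

/-- The functional `g ^ j x ^ l ↦ δ_{l, N}`. -/
def dualX (P : TaftParams k) (N : ℕ) : FiniteDual k (Taft P) := (exists_toDual_eq_single P N).choose

/-- The functional `E₁`. It is set to `0` for `v = 0`, where `m = 1` and the image of `F₁ = 0` must
vanish. -/
def E₁ (P : TaftParams k) : FiniteDual k (Taft P) := if P.v = 0 then 0 else dualX P 1

/-- The functional `E₂`. -/
def E₂ (P : TaftParams k) : FiniteDual k (Taft P) := dualX P P.m

theorem psi_apply [CharZero k] [IsAlgClosed k] (lam : k) (j l : ℕ) :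
    (psi P lam).toDual (g P ^ j * x P ^ l) =
    if P.m ∣ l then lam ^ (l / P.m) else 0 := (exists_toDual_eq_pow P lam).choose_spec j l

theorem omega_apply (j l : ℕ) : (omega P).toDual (g P ^ j * x P ^ l) =
    if l = 0 then P.ξ ^ j else 0 := by
  change lift P.ξ 0 _ _ _ = _
  rw [map_mul, map_pow, map_pow, lift_g, lift_x, zero_pow_eq, mul_ite, mul_one, mul_zero]

theorem dualX_apply (N j l : ℕ) : (dualX P N).toDual (g P ^ j * x P ^ l) =
    if l = N then 1 else 0 := (exists_toDual_eq_single P N).choose_spec j l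

theorem E₂_apply (j l : ℕ) : (E₂ P).toDual (g P ^ j * x P ^ l) =
    if l = P.m then 1 else 0 := dualX_apply _ _ _

theorem toDual_divPow (f : FiniteDual k (Taft P)) (a L r : ℕ) :
    f.toDual (g P ^ a * divPow P L r) = ((L.factorial : k) * qFactorial (P.ξ ^ P.v) r)⁻¹ *
      f.toDual (g P ^ a * x P ^ (P.m * L + r)) := by
  rw [divPow, smul_mul_smul_comm, mul_smul_comm, map_smul, smul_eq_mul, mul_inv, pow_add, pow_mul]

/-- The power series `exp (λ X)`. -/
def expSeries [CharZero k] (lam : k) : PowerSeries k := PowerSeries.rescale lam (PowerSeries.exp k)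

theorem coeff_expSeries [CharZero k] (lam : k) (L : ℕ) :
    PowerSeries.coeff L (expSeries lam) = lam ^ L * (L.factorial : k)⁻¹ := by
  simp [expSeries, PowerSeries.coeff_rescale, PowerSeries.coeff_exp]

theorem hasSymbol_psi [CharZero k] [IsAlgClosed k] (lam : k) :
    HasSymbol (psi P lam) (fun _ => 1) 0 (expSeries lam) := by
  intro a L r hr
  rw [toDual_divPow, psi_apply, coeff_expSeries]
  by_cases h : r = 0
  · subst h
    simp [qFactorial_zero, Nat.mul_div_cancel_left L hr, mul_comm (lam ^ L)]
  · rw [if_neg h, if_neg, mul_zero]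
    rw [Nat.dvd_add_right (dvd_mul_right _ _)]
    exact fun h' => h (Nat.eq_zero_of_dvd_of_lt h' hr)

theorem hasSymbol_omega : HasSymbol (omega P) (fun a => P.ξ ^ a) 0 1 := by
  intro a L r hr
  rw [toDual_divPow, omega_apply, PowerSeries.coeff_one]
  have := P.m_pos
  rcases L with _ | L <;> rcases r with _ | r <;> simp [qFactorial_zero, this.ne']

theorem hasSymbol_E₁ [CharZero k] (hm : P.m ≠ 1) : HasSymbol (E₁ P) (fun _ => 1) 1 1 := by
  intro a L r hr
  rw [E₁, if_neg (fun h => hm (P.m_eq_one_iff.2 h)), toDual_divPow, dualX_apply,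
    PowerSeries.coeff_one]
  rcases L with _ | L
  · by_cases h : r = 1 <;> simp [h, qFactorial_one]
  · rw [if_neg]
    · simp
    · have := P.m_pos
      rw [Nat.mul_succ]
      lia

theorem E₁_eq_zero (hm : P.m = 1) : E₁ P = 0 := if_pos (P.m_eq_one_iff.1 hm)

theorem hasSymbol_E₂ [CharZero k] : HasSymbol (E₂ P) (fun _ => 1) 0 PowerSeries.X := by
  intro a L r hr
  rw [toDual_divPow, E₂_apply, PowerSeries.coeff_X]
  have h : P.m * L + r = P.m ↔ r = 0 ∧ L = 1 := by
    constructor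
    · intro h
      have h1 : L = 1 := by
        rcases L with _ | _ | L
        · lia
        · rfl
        · nlinarith
      subst h1
      lia
    · rintro ⟨rfl, rfl⟩
      simp
  simp only [h]
  by_cases hr : r = 0 <;> by_cases hL : L = 1 <;> simp [hr, hL, qFactorial_zero]

end Taft

/-! ### Exponential polynomials as functionals on polynomials -/

section ExpPolynomials

open Polynomial

variable {k : Type*} [Field k]

/-- A power series `p` viewed as the functional `X ^ L ↦ L! * coeff L p` on polynomials. -/
def polyDual : PowerSeries k →ₗ[k] k[X] →ₗ[k] k where
  toFun p := Polynomial.lsum fun L => (L.factorial * PowerSeries.coeff L p) • LinearMap.id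
  map_add' p p' := by
    ext L
    simp [mul_add]
  map_smul' c p := by
    ext L
    simp [mul_left_comm]

theorem polyDual_X_pow (p : PowerSeries k) (L : ℕ) :
    polyDual p (X ^ L) = L.factorial * PowerSeries.coeff L p := by
  rw [← Polynomial.monomial_one_right_eq_X_pow]
  simp [polyDual]

/-- The exponential polynomial `exp (λ X) X ^ j`. -/
def expMonomial [CharZero k] (y : k × ℕ) : PowerSeries k := Taft.expSeries y.1 * PowerSeries.X ^ y.2

/-- As a functional on polynomials, `exp (λ X) X ^ j` is the evaluation of the `j`-th derivative
at `λ`. -/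
theorem polyDual_expMonomial [CharZero k] (y : k × ℕ) (f : k[X]) :
    polyDual (expMonomial y) f = (derivative^[y.2] f).eval y.1 := by
  suffices h : polyDual (expMonomial y) =
      Polynomial.leval y.1 ∘ₗ (Polynomial.derivative ^ y.2 : Module.End k k[X]) by
    rw [h]
    simp [Module.End.pow_apply, leval_apply]
  refine Polynomial.lhom_ext' fun L => LinearMap.ext_ring ?_
  simp only [LinearMap.comp_apply, Polynomial.monomial_one_right_eq_X_pow, polyDual_X_pow,
    Module.End.pow_apply, leval_apply, iterate_derivative_X_pow_eq_smul, expMonomial,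
    PowerSeries.coeff_mul_X_pow', Taft.coeff_expSeries, eval_smul, eval_pow, eval_X, smul_eq_mul]
  split_ifs with h
  · have h1 : ((L - y.2).factorial : k) ≠ 0 := Nat.cast_ne_zero.2 (Nat.factorial_ne_zero _)
    have h2 : ((L - y.2).factorial : k) * L.descFactorial y.2 = L.factorial := by
      exact_mod_cast Nat.factorial_mul_descFactorial h
    rw [← h2]
    field_simp
  · rw [Nat.descFactorial_eq_zero_iff_lt.2 (by lia)]
    simp

theorem eval_iterate_derivative_eq_zero {f : k[X]} {a : k} {N j : ℕ} (h : (X - C a) ^ N ∣ f)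
    (hj : j < N) : (derivative^[j] f).eval a = 0 := by
  rcases eq_or_ne f 0 with rfl | hf
  · simp
  · exact isRoot_iterate_derivative_of_lt_rootMultiplicity
      (hj.trans_le ((le_rootMultiplicity_iff hf).2 h))

theorem linearIndependent_expMonomial [CharZero k] :
    LinearIndependent k (expMonomial (k := k)) := by
  classical
  rw [linearIndependent_iff']
  intro T c hc y₀ hy₀
  by_contra hne
  obtain ⟨y₁, hy₁, hmax⟩ := Finset.exists_max_image
    (T.filter fun y => y.1 = y₀.1 ∧ c y ≠ 0) Prod.snd ⟨y₀, by simp [hy₀, hne]⟩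
  simp only [Finset.mem_filter] at hy₁ hmax
  -- All terms of the relation vanish at `f` except the one at `y₁`: `f` has a zero of order exactly
  -- `y₁.2` at `y₀.1 = y₁.1`, where the terms with larger `y.2` have coefficient `0`, and one of order
  -- greater than all `y.2` at the other points.
  let N := T.sup Prod.snd + 1
  let Q : k[X] := ∏ b ∈ (T.image Prod.fst).erase y₀.1, (X - C b) ^ N
  let f : k[X] := (X - C y₀.1) ^ y₁.2 * Q
  have hQ : Q.eval y₀.1 ≠ 0 := by
    rw [eval_prod, Finset.prod_ne_zero_iff]
    intro b hb
    rw [eval_pow, eval_sub, eval_X, eval_C]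
    exact pow_ne_zero _ (sub_ne_zero.2 (Finset.ne_of_mem_erase hb).symm)
  have hf : f ≠ 0 := mul_ne_zero (pow_ne_zero _ (X_sub_C_ne_zero _)) (by rintro h; simp [h] at hQ)
  have h1 : (derivative^[y₁.2] f).eval y₀.1 ≠ 0 := by
    intro h
    have h2 : y₁.2 < f.rootMultiplicity y₀.1 := by
      rw [lt_rootMultiplicity_iff_isRoot_iterate_derivative hf]
      intro j hj
      rcases hj.lt_or_eq with hj | rfl
      · exact eval_iterate_derivative_eq_zero (dvd_mul_right _ _) hj
      · exact h
    have h3 : (X - C y₀.1) ^ (y₁.2 + 1) ∣ f := (le_rootMultiplicity_iff hf).1 h2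
    rw [pow_succ, mul_dvd_mul_iff_left (pow_ne_zero _ (X_sub_C_ne_zero _)), dvd_iff_isRoot] at h3
    exact hQ h3
  have h2 := congrArg (fun p => polyDual p f) hc
  simp only [map_sum, map_smul, LinearMap.sum_apply, LinearMap.smul_apply, polyDual_expMonomial,
    map_zero, LinearMap.zero_apply] at h2
  rw [Finset.sum_eq_single_of_mem y₁ hy₁.1, hy₁.2.1, smul_eq_mul] at h2
  · exact (mul_ne_zero hy₁.2.2 h1) h2
  · intro y hy hyne
    by_cases hy0 : y.1 = y₀.1
    · by_cases hcy : c y = 0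
      · simp [hcy]
      · have hle := hmax y ⟨hy, hy0, hcy⟩
        have hlt : y.2 < y₁.2 := lt_of_le_of_ne hle fun h =>
          hyne (Prod.ext (hy0.trans hy₁.2.1.symm) h)
        rw [hy0, eval_iterate_derivative_eq_zero (dvd_mul_right _ _) hlt, smul_zero]
    · have hd : (X - C y.1) ^ N ∣ f := Dvd.dvd.mul_left (Finset.dvd_prod_of_mem _
        (Finset.mem_erase.2 ⟨hy0, Finset.mem_image_of_mem _ hy⟩)) _
      rw [eval_iterate_derivative_eq_zero hd (Nat.lt_succ_of_le (Finset.le_sup hy)), smul_zero]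

/-- A functional on polynomials that vanishes on a nonzero ideal is given by an exponential
polynomial. -/
theorem exists_polyDual_eq [CharZero k] [IsAlgClosed k] (ℓ : k[X] →ₗ[k] k) {p : k[X]} (hp : p ≠ 0)
    (hℓ : ∀ f, p ∣ f → ℓ f = 0) :
    ∃ w ∈ Submodule.span k (Set.range (expMonomial (k := k))), polyDual w = ℓ := by
  classical
  let ι := {y : k × ℕ // y ∈ p.roots.toFinset ×ˢ Finset.range p.natDegree}
  have h : ℓ ∈ Submodule.span k (Set.range fun y : ι => polyDual (expMonomial y.1)) := by
    -- A polynomial killed by these functionals vanishes at the roots of `p` to the order of `p`.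
    apply mem_span_of_iInf_ker_le_ker
    intro f hf
    rw [Submodule.mem_iInf] at hf
    apply hℓ
    rcases eq_or_ne f 0 with rfl | hf0
    · simp
    refine (IsAlgClosed.splits p).dvd_of_roots_le_roots hp (Multiset.le_iff_count.2 fun a => ?_)
    rw [count_roots, count_roots]
    by_contra hlt
    push Not at hlt
    have h1 : f.rootMultiplicity a < f.rootMultiplicity a := by
      rw [lt_rootMultiplicity_iff_isRoot_iterate_derivative hf0]
      intro j hj
      have ha : a ∈ p.roots := by
        rw [← Multiset.count_pos, count_roots]
        lia
      have hdeg : p.rootMultiplicity a ≤ p.natDegree := by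
        rw [← count_roots]
        exact (Multiset.count_le_card _ _).trans (card_roots' p)
      have := hf ⟨(a, j), by simpa [hp] using ⟨(mem_roots'.1 ha).2, by lia⟩⟩
      rw [LinearMap.mem_ker, polyDual_expMonomial] at this
      exact this
    exact lt_irrefl _ h1
  have h2 : Submodule.span k (Set.range fun y : ι => polyDual (expMonomial y.1)) ≤
      (Submodule.span k (Set.range (expMonomial (k := k)))).map polyDual := by
    rw [Submodule.map_span]
    apply Submodule.span_mono
    rintro _ ⟨y, rfl⟩
    exact ⟨_, ⟨y.1, rfl⟩, rfl⟩
  exact h2 h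

end ExpPolynomials

/-! ### The comparison homomorphism -/

namespace Taft

variable {k : Type*} [Field k] {P : TaftParams k}

namespace HasSymbol

variable {f f' : FiniteDual k (Taft P)} {χ χ' : ℕ → k} {i i' : ℕ} {p p' : PowerSeries k}

theorem congr (h : HasSymbol f χ i p) (hχ : ∀ a, χ a = χ' a) (hi : i = i') (hp : p = p') :
    HasSymbol f χ' i' p' := by
  obtain rfl : χ = χ' := funext hχ
  subst hi hp
  exact h

theorem zero : HasSymbol (0 : FiniteDual k (Taft P)) χ i 0 := by
  intro a L r _
  simp

theorem add (h : HasSymbol f χ i p) (h' : HasSymbol f' χ i p') :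
    HasSymbol (f + f') χ i (p + p') := by
  intro a L r hr
  rw [map_add, LinearMap.add_apply, h a L r hr, h' a L r hr]
  split_ifs <;> simp [mul_add]

theorem sum_smul {ι : Type*} (s : Finset ι) (c : ι → k) {F : ι → FiniteDual k (Taft P)}
    {χ : ι → ℕ → k} (h : ∀ j ∈ s, HasSymbol (F j) (χ j) i p) :
    HasSymbol (∑ j ∈ s, c j • F j) (fun a => ∑ j ∈ s, c j * χ j a) i p := by
  intro a L r hr
  simp only [map_sum, map_smul, LinearMap.sum_apply, LinearMap.smul_apply]
  rw [Finset.sum_congr rfl fun j hj => by rw [h j hj a L r hr]]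
  split_ifs <;> simp [Finset.sum_mul, mul_assoc]

end HasSymbol

variable [CharZero k]

theorem hasSymbol_omega_pow (s : ℕ) : HasSymbol (omega P ^ s) (fun a => P.ξ ^ (s * a)) 0 1 := by
  induction s with
  | zero => exact HasSymbol.one.congr (by simp) rfl rfl
  | succ s ih =>
    rw [pow_succ]
    exact (ih.mul hasSymbol_omega).congr (by simp [Nat.succ_mul, pow_add]) rfl (one_mul 1)

theorem hasSymbol_E₁_pow {i : ℕ} (hi : i < P.m) : HasSymbol (E₁ P ^ i) (fun _ => 1) i 1 := by
  induction i with
  | zero => exact HasSymbol.one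
  | succ i ih =>
    rw [pow_succ]
    exact ((ih (by lia)).mul (hasSymbol_E₁ (by lia))).congr (by simp) rfl (one_mul 1)

theorem hasSymbol_E₂_pow (j : ℕ) : HasSymbol (E₂ P ^ j) (fun _ => 1) 0 (PowerSeries.X ^ j) := by
  induction j with
  | zero => exact HasSymbol.one
  | succ j ih =>
    rw [pow_succ]
    exact (ih.mul hasSymbol_E₂).congr (by simp) rfl (pow_succ _ _).symm

theorem omega_pow_n : omega P ^ P.n = 1 :=
  (hasSymbol_omega_pow P.n).unique
    (HasSymbol.one.congr (by simp [pow_mul, P.primitive.pow_eq_one]) rfl rfl)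

theorem E₁_pow_m : E₁ P ^ P.m = 0 := by
  by_cases hm : P.m = 1
  · rw [hm, pow_one, E₁_eq_zero hm]
  · have := P.m_pos
    obtain ⟨l, hl⟩ : ∃ l, P.m = l + 1 := ⟨P.m - 1, by lia⟩
    rw [hl, pow_succ]
    exact (hasSymbol_E₁_pow (by lia)).mul_eq_zero (hasSymbol_E₁ hm) (by lia)

theorem E₁_mul_omega : E₁ P * omega P = P.ξ ^ P.v • (omega P * E₁ P) := by
  by_cases hm : P.m = 1
  · simp [E₁_eq_zero hm]
  · refine finiteDual_ext fun a L r hr => ?_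
    rw [map_smul, LinearMap.smul_apply, (hasSymbol_E₁ hm).mul hasSymbol_omega a L r hr,
      hasSymbol_omega.mul (hasSymbol_E₁ hm) a L r hr]
    split_ifs <;> simp_all [pow_add, mul_comm]

variable [IsAlgClosed k]

/-- The algebra homomorphism from `TaftDual P` to the finite dual of the Taft algebra. -/
def theta (P : TaftParams k) : TaftDual P →ₐ[k] FiniteDual k (Taft P) :=
  RingQuot.liftAlgHom k ⟨FreeAlgebra.lift k fun
      | .Psi lam => psi P lam
      | .Omega => omega P
      | .F₁ => E₁ P
      | .F₂ => E₂ P, by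
    intro a b h
    cases h with
    | Psi_mul_Psi a b =>
      simpa using ((hasSymbol_psi a).mul (hasSymbol_psi b)).unique
        ((hasSymbol_psi (a + b)).congr (by simp) rfl (PowerSeries.exp_mul_exp_eq_exp_add a b).symm)
    | Psi_zero =>
      simpa using (hasSymbol_psi 0).unique (HasSymbol.one.congr (by simp) rfl
        (by simp [expSeries]))
    | Omega_pow => simpa using omega_pow_n
    | F₁_pow => simpa using E₁_pow_m
    | Omega_mul_Psi a =>
      simpa using (hasSymbol_omega.mul (hasSymbol_psi a)).unique
        (((hasSymbol_psi a).mul hasSymbol_omega).congr (by simp) rfl (mul_comm _ _))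
    | F₂_mul_Omega =>
      simpa using (hasSymbol_E₂.mul hasSymbol_omega).unique
        ((hasSymbol_omega.mul hasSymbol_E₂).congr (by simp) rfl (mul_comm _ _))
    | F₁_mul_Omega => simpa using E₁_mul_omega
    | F₂_mul_Psi a =>
      simpa using (hasSymbol_E₂.mul (hasSymbol_psi a)).unique
        (((hasSymbol_psi a).mul hasSymbol_E₂).congr (by simp) rfl (mul_comm _ _))
    | F₁_mul_Psi a =>
      by_cases hm : P.m = 1
      · simp [E₁_eq_zero hm]
      · simpa using ((hasSymbol_E₁ hm).mul (hasSymbol_psi a)).unique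
          (((hasSymbol_psi a).mul (hasSymbol_E₁ hm)).congr (by simp) (by simp) (mul_comm _ _))
    | F₁_mul_F₂ =>
      by_cases hm : P.m = 1
      · simp [E₁_eq_zero hm]
      · simpa using ((hasSymbol_E₁ hm).mul hasSymbol_E₂).unique
          ((hasSymbol_E₂.mul (hasSymbol_E₁ hm)).congr (by simp) (by simp) (mul_comm _ _))⟩

@[simp] theorem theta_Psi (lam : k) : theta P (TaftDual.Psi P lam) = psi P lam := by
  refine (RingQuot.liftAlgHom_mkAlgHom_apply _ _ _ _).trans ?_
  simp

@[simp] theorem theta_Omega : theta P (TaftDual.Omega P) = omega P := by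
  refine (RingQuot.liftAlgHom_mkAlgHom_apply _ _ _ _).trans ?_
  simp

@[simp] theorem theta_F₁ : theta P (TaftDual.F₁ P) = E₁ P := by
  refine (RingQuot.liftAlgHom_mkAlgHom_apply _ _ _ _).trans ?_
  simp

@[simp] theorem theta_F₂ : theta P (TaftDual.F₂ P) = E₂ P := by
  refine (RingQuot.liftAlgHom_mkAlgHom_apply _ _ _ _).trans ?_
  simp

end Taft

namespace TaftDual

variable {k : Type*} [Field k] {P : TaftParams k}

theorem mk_rel {a b : FreeAlgebra k (TaftDualGen k)} (h : TaftDualRel P a b) :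
    mk P a = mk P b := RingQuot.mkAlgHom_rel k h

theorem adjoin_eq_top : Algebra.adjoin k
    (Set.range (Psi P) ∪ {Omega P, F₁ P, F₂ P}) = ⊤ := by
  rw [eq_top_iff]
  intro a _
  obtain ⟨y, rfl⟩ := RingQuot.mkAlgHom_surjective k (TaftDualRel P) a
  change mk P y ∈ _
  induction y using FreeAlgebra.induction with
  | grade0 r => rw [AlgHom.commutes]; exact Subalgebra.algebraMap_mem _ r
  | grade1 c =>
    cases c with
    | Psi lam => exact Algebra.subset_adjoin (Or.inl ⟨lam, rfl⟩)
    | Omega => exact Algebra.subset_adjoin (Or.inr (Or.inl rfl))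
    | F₁ => exact Algebra.subset_adjoin (Or.inr (Or.inr (Or.inl rfl)))
    | F₂ => exact Algebra.subset_adjoin (Or.inr (Or.inr (Or.inr rfl)))
  | mul a b ha hb => simpa using mul_mem (ha trivial) (hb trivial)
  | add a b ha hb => rw [map_add]; exact add_mem (ha trivial) (hb trivial)

/-- The monomials `Ψ_λ Ω ^ s F₁ ^ i F₂ ^ j`. -/
def monomial (P : TaftParams k) (lam : k) (s i j : ℕ) : TaftDual P :=
  Psi P lam * Omega P ^ s * F₁ P ^ i * F₂ P ^ j

theorem Psi_mul_monomial (μ lam : k) (s i j : ℕ) :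
    Psi P μ * monomial P lam s i j = monomial P (μ + lam) s i j := by
  have h : Psi P μ * Psi P lam = Psi P (μ + lam) := by
    simpa [Psi, Omega, F₁, F₂] using mk_rel (.Psi_mul_Psi (P := P) μ lam)
  simp only [monomial, ← mul_assoc, h]

theorem Omega_mul_monomial (lam : k) (s i j : ℕ) :
    Omega P * monomial P lam s i j = monomial P lam (s + 1) i j := by
  have h : Omega P * Psi P lam = Psi P lam * Omega P := by
    simpa [Psi, Omega, F₁, F₂] using mk_rel (.Omega_mul_Psi (P := P) lam)
  simp only [monomial, ← mul_assoc, h]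
  rw [mul_assoc _ (Omega P), ← pow_succ']

theorem F₁_mul_Omega_pow (s : ℕ) :
    F₁ P * Omega P ^ s = P.ξ ^ (P.v * s) • (Omega P ^ s * F₁ P) := by
  have h : F₁ P * Omega P = P.ξ ^ P.v • (Omega P * F₁ P) := by
    simpa [Psi, Omega, F₁, F₂] using mk_rel (.F₁_mul_Omega (P := P))
  induction s with
  | zero => simp
  | succ s ih =>
    rw [pow_succ, ← mul_assoc, ih, smul_mul_assoc, mul_assoc, h, mul_smul_comm, smul_smul,
      ← mul_assoc, Nat.mul_succ, pow_add]

theorem F₁_mul_monomial (lam : k) (s i j : ℕ) :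
    F₁ P * monomial P lam s i j = P.ξ ^ (P.v * s) • monomial P lam s (i + 1) j := by
  have h : F₁ P * Psi P lam = Psi P lam * F₁ P := by
    simpa [Psi, Omega, F₁, F₂] using mk_rel (.F₁_mul_Psi (P := P) lam)
  simp only [monomial, ← mul_assoc, h]
  rw [mul_assoc _ (F₁ P), F₁_mul_Omega_pow]
  simp only [mul_smul_comm, smul_mul_assoc, pow_succ', mul_assoc]

theorem F₂_mul_monomial (lam : k) (s i j : ℕ) :
    F₂ P * monomial P lam s i j = monomial P lam s i (j + 1) := by
  have h1 : Commute (F₂ P) (Psi P lam) := by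
    change _ * _ = _ * _
    simpa [Psi, Omega, F₁, F₂] using mk_rel (.F₂_mul_Psi (P := P) lam)
  have h2 : Commute (F₂ P) (Omega P) := by
    change _ * _ = _ * _
    simpa [Psi, Omega, F₁, F₂] using mk_rel (.F₂_mul_Omega (P := P))
  have h3 : Commute (F₂ P) (F₁ P) := by
    change _ * _ = _ * _
    simpa [Psi, Omega, F₁, F₂] using (mk_rel (.F₁_mul_F₂ (P := P))).symm
  have h4 := (h1.mul_right (h2.pow_right s)).mul_right (h3.pow_right i)
  rw [monomial, ← mul_assoc, h4.eq, mul_assoc, ← pow_succ', monomial]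

theorem Psi_zero : Psi P 0 = 1 := by simpa [Psi] using mk_rel (.Psi_zero (P := P))

theorem span_monomial_nat : Submodule.span k
    (Set.range fun t : (ℕ × ℕ) × (k × ℕ) => monomial P t.2.1 t.1.1 t.1.2 t.2.2) = ⊤ := by
  refine Submodule.span_eq_top_of_forall_mul_mem adjoin_eq_top
    (Submodule.subset_span ⟨((0, 0), (0, 0)), by simp [monomial, Psi_zero]⟩) ?_
  rintro _ (⟨μ, rfl⟩ | rfl | rfl | rfl) _ ⟨⟨⟨s, i⟩, ⟨lam, j⟩⟩, rfl⟩
  · exact Submodule.subset_span ⟨((s, i), (μ + lam, j)), (Psi_mul_monomial _ _ _ _ _).symm⟩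
  · exact Submodule.subset_span ⟨((s + 1, i), (lam, j)), (Omega_mul_monomial _ _ _ _).symm⟩
  · rw [F₁_mul_monomial]
    exact Submodule.smul_mem _ _ (Submodule.subset_span ⟨((s, i + 1), (lam, j)), rfl⟩)
  · exact Submodule.subset_span ⟨((s, i), (lam, j + 1)), (F₂_mul_monomial _ _ _ _).symm⟩

/-- The monomials that form a basis. -/
def basisMonomial (P : TaftParams k) (t : (Fin P.n × Fin P.m) × (k × ℕ)) : TaftDual P :=
  monomial P t.2.1 t.1.1 t.1.2 t.2.2

theorem span_basisMonomial : Submodule.span k (Set.range (basisMonomial P)) = ⊤ := by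
  rw [eq_top_iff, ← span_monomial_nat, Submodule.span_le]
  rintro _ ⟨⟨⟨s, i⟩, y⟩, rfl⟩
  by_cases hi : i < P.m
  · refine Submodule.subset_span ⟨((⟨s % P.n, Nat.mod_lt _ P.n_pos⟩, ⟨i, hi⟩), y), ?_⟩
    have h : Omega P ^ P.n = 1 := by simpa [Psi, Omega, F₁, F₂] using mk_rel (.Omega_pow (P := P))
    simp only [basisMonomial, monomial]
    congr 3
    conv_rhs => rw [← Nat.mod_add_div s P.n, pow_add, pow_mul, h, one_pow, mul_one]
  · have h : F₁ P ^ P.m = 0 := by simpa [Psi, Omega, F₁, F₂] using mk_rel (.F₁_pow (P := P))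
    have h' : F₁ P ^ i = 0 := by
      rw [← Nat.add_sub_cancel' (not_lt.1 hi), pow_add, h, zero_mul]
    simp [monomial, h']

end TaftDual

/-! ### Bijectivity of the comparison homomorphism -/

/-- A relation among the `v t.2` over the pairs `t` with a fixed first component is trivial, as
these `t` have distinct second components. -/
theorem LinearIndependent.eq_zero_of_sum_filter_fst {k V ι κ : Type*} [Field k] [AddCommGroup V]
    [Module k V] [DecidableEq ι] {v : κ → V} (hv : LinearIndependent k v) {T : Finset (ι × κ)}
    {c : ι × κ → k} {x : ι} (h : ∑ t ∈ T.filter (fun t => t.1 = x), c t • v t.2 = 0) :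
    ∀ t ∈ T, t.1 = x → c t = 0 := by
  intro t ht htx
  have hinj : Function.Injective fun t : {t : ι × κ // t.1 = x} => t.1.2 :=
    fun t t' h => Subtype.ext (Prod.ext (t.2.trans t'.2.symm) h)
  exact linearIndependent_iff'.1 (hv.comp _ hinj) (T.subtype fun t => t.1 = x) (fun t => c t.1)
    ((Finset.sum_subtype_eq_sum_filter (s := T) (p := fun t => t.1 = x)
      (fun t => c t • v t.2)).trans h) ⟨t, htx⟩ (by simpa using ht)

namespace Taft

variable {k : Type*} [Field k] [CharZero k] [IsAlgClosed k] {P : TaftParams k}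

open TaftDual (basisMonomial)

theorem hasSymbol_theta_basisMonomial (t : (Fin P.n × Fin P.m) × (k × ℕ)) :
    HasSymbol (theta P (basisMonomial P t)) (fun a => P.ξ ^ (t.1.1 * a)) t.1.2
      (expMonomial t.2) := by
  simp only [basisMonomial, TaftDual.monomial, map_mul, map_pow, theta_Psi, theta_Omega, theta_F₁,
    theta_F₂]
  exact ((((hasSymbol_psi t.2.1).mul (hasSymbol_omega_pow t.1.1)).mul
    (hasSymbol_E₁_pow t.1.2.2)).mul (hasSymbol_E₂_pow t.2.2)).congr (by simp) (by simp)
      (by simp [expMonomial])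

theorem linearIndependent_theta_basisMonomial :
    LinearIndependent k fun t => theta P (basisMonomial P t) := by
  classical
  rw [linearIndependent_iff']
  intro T c hc t₀ ht₀
  have hn : (P.n : k) ≠ 0 := Nat.cast_ne_zero.2 P.n_pos.ne'
  -- The Fourier coefficient at `t₀.1.1` of the relation, as a function of `a`, singles out the
  -- terms with the same exponents of `Ω` and `F₁` as `t₀`.
  have key : ∑ t ∈ T.filter (fun t => t.1 = t₀.1), c t • expMonomial t.2 = 0 := by
    ext L
    have h1 : ∀ a, ∑ t ∈ T, (if t.1.2 = t₀.1.2 then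
        c t * (P.ξ ^ (t.1.1 * a : ℕ) * PowerSeries.coeff L (expMonomial t.2)) else 0) = 0 := by
      intro a
      have h2 := congrArg (fun f => f.toDual (g P ^ a * divPow P L t₀.1.2)) hc
      simp only [map_sum, map_smul, LinearMap.sum_apply, LinearMap.smul_apply, map_zero,
        LinearMap.zero_apply, smul_eq_mul] at h2
      refine Eq.trans ?_ h2
      refine Finset.sum_congr rfl fun t _ => ?_
      rw [hasSymbol_theta_basisMonomial t a L _ t₀.1.2.2]
      simp only [eq_comm, Fin.ext_iff, mul_ite, mul_zero]
    have h3 : ∑ a ∈ Finset.range P.n, (P.ξ⁻¹) ^ (a * t₀.1.1 : ℕ) * ∑ t ∈ T,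
        (if t.1.2 = t₀.1.2 then
          c t * (P.ξ ^ (t.1.1 * a : ℕ) * PowerSeries.coeff L (expMonomial t.2)) else 0) = 0 :=
      Finset.sum_eq_zero fun a _ => by rw [h1, mul_zero]
    simp only [Finset.mul_sum] at h3
    rw [Finset.sum_comm] at h3
    have h4 : ∀ t ∈ T, ∑ a ∈ Finset.range P.n, (P.ξ⁻¹) ^ (a * t₀.1.1 : ℕ) *
        (if t.1.2 = t₀.1.2 then
          c t * (P.ξ ^ (t.1.1 * a : ℕ) * PowerSeries.coeff L (expMonomial t.2)) else 0) =
        P.n * if t.1 = t₀.1 then c t * PowerSeries.coeff L (expMonomial t.2) else 0 := by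
      intro t _
      by_cases h5 : t.1.2 = t₀.1.2
      · have h6 : (t.1 = t₀.1) ↔ (t.1.1 : ℕ) ≡ t₀.1.1 [MOD P.n] := by
          rw [Prod.ext_iff, and_iff_left h5, Fin.ext_iff, Nat.ModEq, Nat.mod_eq_of_lt t.1.1.2,
            Nat.mod_eq_of_lt t₀.1.1.2]
        have h7 := P.primitive.sum_inv_pow_mul_pow P.n_pos t₀.1.1 t.1.1
        simp only [if_pos h5, h6]
        calc _ = (∑ a ∈ Finset.range P.n, (P.ξ⁻¹) ^ (a * t₀.1.1 : ℕ) * P.ξ ^ (a * t.1.1 : ℕ)) *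
              (c t * PowerSeries.coeff L (expMonomial t.2)) := by
              rw [Finset.sum_mul]
              refine Finset.sum_congr rfl fun a _ => ?_
              rw [mul_comm a (t.1.1 : ℕ)]
              ring
          _ = _ := by
              rw [h7]
              split_ifs <;> simp
      · have h6 : t.1 ≠ t₀.1 := fun h => h5 (by rw [h])
        simp [h5, h6]
    rw [Finset.sum_congr rfl h4, ← Finset.mul_sum, mul_eq_zero, or_iff_right hn] at h3
    rw [map_sum, Finset.sum_filter, map_zero]
    simpa using h3
  exact LinearIndependent.eq_zero_of_sum_filter_fst (k := k) (v := expMonomial)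
    linearIndependent_expMonomial (T := T) (c := c) (x := t₀.1) key t₀ ht₀ rfl

theorem theta_injective : Function.Injective (theta P) := by
  rw [injective_iff_map_eq_zero]
  intro a ha
  have h : a ∈ Submodule.span k (Set.range (basisMonomial P)) := by
    rw [TaftDual.span_basisMonomial]
    trivial
  obtain ⟨c, rfl⟩ := Finsupp.mem_span_range_iff_exists_finsupp.1 h
  have h2 : Finsupp.linearCombination k (fun t => theta P (basisMonomial P t)) c = 0 := by
    rw [← ha, Finsupp.linearCombination_apply, map_finsuppSum]
    simp only [map_smul]
  rw [linearIndependent_iff.1 linearIndependent_theta_basisMonomial c h2]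
  simp

theorem exists_hasSymbol_of_mem_span {w : PowerSeries k}
    (hw : w ∈ Submodule.span k (Set.range (expMonomial (k := k)))) :
    ∃ f ∈ (theta P).range, HasSymbol f (fun _ => 1) 0 w := by
  induction hw using Submodule.span_induction with
  | mem w hw =>
    obtain ⟨y, rfl⟩ := hw
    refine ⟨psi P y.1 * E₂ P ^ y.2, ⟨TaftDual.Psi P y.1 * TaftDual.F₂ P ^ y.2, by simp⟩, ?_⟩
    exact ((hasSymbol_psi y.1).mul (hasSymbol_E₂_pow y.2)).congr (by simp) rfl rfl
  | zero => exact ⟨0, zero_mem _, HasSymbol.zero⟩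
  | add w w' _ _ hw hw' =>
    obtain ⟨f, hf, h⟩ := hw
    obtain ⟨f', hf', h'⟩ := hw'
    exact ⟨f + f', add_mem hf hf', h.add h'⟩
  | smul c w _ hw =>
    obtain ⟨f, hf, h⟩ := hw
    exact ⟨c • f, Subalgebra.smul_mem _ hf c, h.smul c⟩

/-- By Fourier inversion, `n⁻¹ ∑_s ξ ^ (- s c) ω ^ s` is the indicator function of `g ^ c`. -/
theorem exists_hasSymbol_indicator (c : ℕ) :
    ∃ f ∈ (theta P).range, HasSymbol f (fun a => if a ≡ c [MOD P.n] then 1 else 0) 0 1 := by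
  have hn : (P.n : k) ≠ 0 := Nat.cast_ne_zero.2 P.n_pos.ne'
  refine ⟨∑ s ∈ Finset.range P.n, ((P.n : k)⁻¹ * (P.ξ⁻¹) ^ (s * c)) • omega P ^ s,
    sum_mem fun s _ => Subalgebra.smul_mem _
      (AlgHom.mem_range _ |>.2 ⟨TaftDual.Omega P ^ s, by simp⟩) _, ?_⟩
  refine (HasSymbol.sum_smul _ _ fun s _ => hasSymbol_omega_pow s).congr (fun a => ?_) rfl rfl
  simp only [mul_assoc]
  rw [← Finset.mul_sum, P.primitive.sum_inv_pow_mul_pow P.n_pos]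
  split_ifs <;> simp [hn]

/-- If `f` vanishes on an ideal of finite codimension, and `p` is the minimal polynomial of `x ^ m`
modulo that ideal, then `F ↦ f (g ^ a F(x ^ m) x ^ r)` vanishes on the multiples of `p`. -/
theorem exists_mem_span_expMonomial (f : FiniteDual k (Taft P)) (a r : ℕ) :
    ∃ w ∈ Submodule.span k (Set.range (expMonomial (k := k))),
      ∀ L, f.toDual (g P ^ a * divPow P L r) = PowerSeries.coeff L w := by
  open Polynomial in
  obtain ⟨I, hI, hfin, β, hβ⟩ := VanishesOnCofinite.exists_algHom f.2
  let π := Ideal.Quotient.mkₐ k I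
  let p := minpoly k (π (x P ^ P.m))
  have hp : p ≠ 0 := minpoly.ne_zero (IsIntegral.of_finite k _)
  let ℓ : k[X] →ₗ[k] k := f.toDual ∘ₗ LinearMap.mulLeft k (g P ^ a) ∘ₗ
    LinearMap.mulRight k ((qFactorial (P.ξ ^ P.v) r)⁻¹ • x P ^ r) ∘ₗ
      (Polynomial.aeval (x P ^ P.m)).toLinearMap
  have hℓ : ∀ F, p ∣ F → ℓ F = 0 := by
    rintro _ ⟨F, rfl⟩
    have h1 : Polynomial.aeval (π (x P ^ P.m)) p = 0 := minpoly.aeval _ _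
    have h2 : ∀ b, f.toDual b = β (π b) := fun b => LinearMap.congr_fun hβ b
    simp only [ℓ, LinearMap.comp_apply, AlgHom.toLinearMap_apply, LinearMap.mulLeft_apply,
      LinearMap.mulRight_apply, h2, map_mul]
    rw [← Polynomial.aeval_algHom_apply, h1, zero_mul, zero_mul, mul_zero, map_zero]
  obtain ⟨w, hw, hwℓ⟩ := exists_polyDual_eq ℓ hp hℓ
  refine ⟨w, hw, fun L => ?_⟩
  have hL : (L.factorial : k) ≠ 0 := Nat.cast_ne_zero.2 L.factorial_ne_zero
  have h1 : ℓ (X ^ L) = L.factorial * PowerSeries.coeff L w := by rw [← hwℓ, polyDual_X_pow]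
  have h2 : ℓ (X ^ L) = L.factorial * f.toDual (g P ^ a * divPow P L r) := by
    simp only [ℓ, divPow, LinearMap.comp_apply, AlgHom.toLinearMap_apply, LinearMap.mulLeft_apply,
      LinearMap.mulRight_apply, map_pow, Polynomial.aeval_X, mul_smul_comm, smul_mul_assoc,
      map_smul, smul_eq_mul]
    field_simp
  exact mul_left_cancel₀ hL (h2.symm.trans h1)

/-- The functional `f` is reassembled from its restrictions to the spans of the
`g ^ c x ^ (m L + i)`, `L ≥ 0`, for fixed `c < n` and `i < m`. -/
theorem theta_surjective : Function.Surjective (theta P) := by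
  intro f
  choose w hw hfw using exists_mem_span_expMonomial f
  choose D hD hDs using fun c => exists_hasSymbol_indicator (P := P) c
  choose W hW hWs using fun c i => exists_hasSymbol_of_mem_span (P := P) (hw c i)
  suffices h : f = ∑ c ∈ Finset.range P.n, ∑ i ∈ Finset.range P.m, D c * W c i * E₁ P ^ i by
    have : f ∈ (theta P).range := by
      rw [h]
      exact sum_mem fun c _ => sum_mem fun i _ =>
        mul_mem (mul_mem (hD c) (hW c i))
          (pow_mem (AlgHom.mem_range _ |>.2 ⟨TaftDual.F₁ P, by simp⟩) i)
    exact this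
  refine finiteDual_ext fun a L r hr => ?_
  have hs : ∀ c, ∀ i ∈ Finset.range P.m,
      (D c * W c i * E₁ P ^ i).toDual (g P ^ a * divPow P L r) =
        if i = r then (if a ≡ c [MOD P.n] then PowerSeries.coeff L (w c i) else 0) else 0 := by
    intro c i hi
    have := ((hDs c).mul (hWs c i)).mul (hasSymbol_E₁_pow (Finset.mem_range.1 hi)) a L r hr
    rw [this]
    simp [eq_comm]
  simp only [map_sum, LinearMap.sum_apply]
  rw [Finset.sum_congr rfl fun c _ => Finset.sum_congr rfl (hs c)]
  simp only [Finset.sum_ite_eq', Finset.mem_range, hr, if_true]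
  rw [Finset.sum_eq_single_of_mem (a % P.n) (Finset.mem_range.2 (Nat.mod_lt _ P.n_pos)),
    if_pos (Nat.mod_modEq a P.n).symm, ← hfw, g_pow_mod]
  intro c hc hne
  rw [if_neg]
  intro h
  exact hne (by rw [h, Nat.mod_eq_of_lt (Finset.mem_range.1 hc)])

/-- The algebra isomorphism onto the finite dual. -/
def thetaEquiv (P : TaftParams k) : TaftDual P ≃ₐ[k] FiniteDual k (Taft P) :=
  AlgEquiv.ofBijective (theta P) ⟨theta_injective, theta_surjective⟩

end Taft

/-! ### Comultiplication of the generating functionals -/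

namespace Taft

variable {k : Type*} [Field k] {P : TaftParams k}

/-- As `g ^ a x ^ l g ^ a' x ^ l' = ξ ^ (l a') g ^ (a + a') x ^ (l + l')`, this is the
characterization of the comultiplication of the finite dual, on monomials. -/
theorem comul_eq_of_pair₂ {f : FiniteDual k (Taft P)}
    {t : FiniteDual k (Taft P) ⊗[k] FiniteDual k (Taft P)}
    (h : ∀ a l a' l', FiniteDual.pair₂ t ((g P ^ a * x P ^ l) ⊗ₜ (g P ^ a' * x P ^ l')) =
        P.ξ ^ (l * a') * f.toDual (g P ^ (a + a') * x P ^ (l + l'))) :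
    FiniteDual.comul f = t := by
  apply FiniteDual.pair₂_injective
  rw [FiniteDual.pair₂_comul]
  refine TensorProduct.ext (linearMap_ext fun a l => linearMap_ext fun a' l' => ?_)
  change FiniteDual.mulDual f (_ ⊗ₜ[k] _) = FiniteDual.pair₂ t (_ ⊗ₜ[k] _)
  rw [h, FiniteDual.mulDual_tmul, mul_assoc, ← mul_assoc (x P ^ l), x_pow_mul_g_pow, smul_mul_assoc,
    mul_smul_comm, map_smul, mul_assoc, ← pow_add, ← mul_assoc, ← pow_add, smul_eq_mul]

theorem comul_eq_of_pair₂_of_lt {f : FiniteDual k (Taft P)}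
    {t : FiniteDual k (Taft P) ⊗[k] FiniteDual k (Taft P)}
    (h : ∀ a L r a' L' r', r < P.m → r' < P.m →
      FiniteDual.pair₂ t
        ((g P ^ a * x P ^ (P.m * L + r)) ⊗ₜ (g P ^ a' * x P ^ (P.m * L' + r'))) =
        P.ξ ^ ((P.m * L + r) * a') *
          f.toDual (g P ^ (a + a') * x P ^ (P.m * L + r + (P.m * L' + r')))) :
    FiniteDual.comul f = t := by
  refine comul_eq_of_pair₂ fun a l a' l' => ?_
  have := h a (l / P.m) (l % P.m) a' (l' / P.m) (l' % P.m) (Nat.mod_lt _ P.m_pos)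
    (Nat.mod_lt _ P.m_pos)
  simpa only [Nat.div_add_mod] using this

theorem comul_omega : FiniteDual.comul (omega P) = omega P ⊗ₜ[k] omega P := by
  refine comul_eq_of_pair₂ fun a l a' l' => ?_
  rw [FiniteDual.pair₂_tmul, omega_apply, omega_apply, omega_apply]
  rcases l with _ | l <;> rcases l' with _ | l' <;> simp [pow_add]

theorem comul_E₁ : FiniteDual.comul (E₁ P) = 1 ⊗ₜ[k] E₁ P + E₁ P ⊗ₜ[k] omega P := by
  by_cases hv : P.v = 0
  · simp [E₁_eq_zero (P.m_eq_one_iff.2 hv)]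
  have hE : ∀ j l, (E₁ P).toDual (g P ^ j * x P ^ l) = if l = 1 then 1 else 0 := fun j l => by
    rw [E₁, if_neg hv, dualX_apply]
  refine comul_eq_of_pair₂ fun a l a' l' => ?_
  rw [map_add, LinearMap.add_apply, FiniteDual.pair₂_tmul, FiniteDual.pair₂_tmul, omega_apply,
    hE, hE, hE, one_apply]
  rcases l with _ | _ | l <;> rcases l' with _ | _ | l' <;> simp
  exact fun h => absurd h (by lia)

/-- The divided power `E₁ ^ i / i!_q`. -/
def E₁div (P : TaftParams k) (i : ℕ) : FiniteDual k (Taft P) :=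
  (qFactorial (P.ξ ^ P.v) i)⁻¹ • E₁ P ^ i

/-- The idempotent `(m / n) ∑_i ξ ^ (- i m c) ω ^ (i m)`, the image of `ς_c`, which restricts to the
indicator function of the set of `g ^ a` with `a ≡ c mod n / m`. -/
def indicator (P : TaftParams k) (c : ℕ) : FiniteDual k (Taft P) :=
  ((P.m : k) / (P.n : k)) •
    ∑ i ∈ Finset.range (P.n / P.m), (P.ξ⁻¹) ^ (i * P.m * c) • omega P ^ (i * P.m)

/-- The element `∑_{1 ≤ i ≤ m - 1} E₁^[i] ⊗ ω ^ i E₁^[m - i]`. -/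
def cross (P : TaftParams k) : FiniteDual k (Taft P) ⊗[k] FiniteDual k (Taft P) :=
  ∑ i ∈ Finset.Ico 1 P.m, E₁div P i ⊗ₜ[k] (omega P ^ i * E₁div P (P.m - i))

theorem E₁div_zero : E₁div P 0 = 1 := by simp [E₁div, qFactorial_zero]

theorem hasSymbol_indicator [CharZero k] (c : ℕ) : HasSymbol (indicator P c)
    (fun a => if a ≡ c [MOD P.n / P.m] then 1 else 0) 0 1 := by
  have hn : (P.n : k) ≠ 0 := Nat.cast_ne_zero.2 P.n_pos.ne'
  have hm : (P.m : k) ≠ 0 := Nat.cast_ne_zero.2 P.m_pos.ne'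
  have hζ : IsPrimitiveRoot (P.ξ ^ P.m) (P.n / P.m) :=
    P.primitive.pow P.n_pos (Nat.mul_div_cancel' P.m_dvd).symm
  have hpos : 0 < P.n / P.m := Nat.div_pos P.m_le P.m_pos
  rw [indicator, Finset.smul_sum]
  simp only [smul_smul]
  refine (HasSymbol.sum_smul _ _ fun i _ => hasSymbol_omega_pow (i * P.m)).congr
    (fun a => ?_) rfl rfl
  have h := hζ.sum_inv_pow_mul_pow hpos c a
  have h' : ∀ i, (P.m : k) / P.n * P.ξ⁻¹ ^ (i * P.m * c) * P.ξ ^ (i * P.m * a) =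
      (P.m : k) / P.n * ((P.ξ ^ P.m)⁻¹ ^ (i * c) * (P.ξ ^ P.m) ^ (i * a)) := by
    intro i
    rw [← inv_pow, ← pow_mul, ← pow_mul, mul_assoc, mul_comm i P.m, mul_assoc P.m, mul_assoc P.m]
  simp only [h']
  rw [← Finset.mul_sum, h, Nat.cast_div P.m_dvd hm]
  split_ifs
  · field_simp
  · simp

theorem hasSymbol_E₁div [CharZero k] {i : ℕ} (hi : i < P.m) : HasSymbol (E₁div P i) (fun _ => 1) i
    ((qFactorial (P.ξ ^ P.v) i)⁻¹ • (1 : PowerSeries k)) := (hasSymbol_E₁_pow hi).smul _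

theorem E₂_apply' [CharZero k] (a L : ℕ) {r : ℕ} (hr : r < P.m) :
    (E₂ P).toDual (g P ^ a * x P ^ (P.m * L + r)) = if r = 0 ∧ L = 1 then 1 else 0 := by
  rw [hasSymbol_E₂.apply_x_pow a L hr, PowerSeries.coeff_X]
  by_cases h : r = 0 <;> by_cases h' : L = 1 <;> simp [h, h', qFactorial_zero]

variable [CharZero k] [IsAlgClosed k]

theorem psi_zero : psi P 0 = 1 := by rw [← theta_Psi, TaftDual.Psi_zero, map_one]

/-- The general form of the functionals in the comultiplication of `ψ_λ`. The values of its factors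
follow by putting `λ = 0` (as `ψ_0 = 1`), `D = 1` or `i = 0`. -/
theorem psi_mul_mul_E₁div_apply {D : FiniteDual k (Taft P)} {χ : ℕ → k} (hD : HasSymbol D χ 0 1)
    (lam : k) {i : ℕ} (hi : i < P.m) (a L : ℕ) {r : ℕ} (hr : r < P.m) :
    (psi P lam * D * E₁div P i).toDual (g P ^ a * x P ^ (P.m * L + r)) =
      if r = i then χ a * lam ^ L else 0 := by
  rw [(((hasSymbol_psi lam).mul hD).mul (hasSymbol_E₁div hi)).apply_x_pow a L hr]
  have h1 : (L.factorial : k) ≠ 0 := Nat.cast_ne_zero.2 L.factorial_ne_zero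
  have h2 := qFactorial_ne_zero P.q_primitive hi
  simp only [zero_add, mul_zero, add_zero, one_mul, mul_one, mul_smul_comm, map_smul, smul_eq_mul,
    coeff_expSeries]
  split_ifs with h
  · subst h
    field_simp
  · rfl

theorem psi_mul_apply {D : FiniteDual k (Taft P)} {χ : ℕ → k} (hD : HasSymbol D χ 0 1)
    (lam : k) (a L : ℕ) {r : ℕ} (hr : r < P.m) :
    (psi P lam * D).toDual (g P ^ a * x P ^ (P.m * L + r)) =
      if r = 0 then χ a * lam ^ L else 0 := by
  have := psi_mul_mul_E₁div_apply hD lam P.m_pos a L hr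
  rwa [E₁div_zero, mul_one] at this

theorem psi_mul_E₁div_apply (lam : k) {i : ℕ} (hi : i < P.m) (a L : ℕ) {r : ℕ} (hr : r < P.m) :
    (psi P lam * E₁div P i).toDual (g P ^ a * x P ^ (P.m * L + r)) =
      if r = i then lam ^ L else 0 := by
  have := psi_mul_mul_E₁div_apply HasSymbol.one lam hi a L hr
  rwa [mul_one, one_mul] at this

theorem E₁div_apply {i : ℕ} (hi : i < P.m) (a L : ℕ) {r : ℕ} (hr : r < P.m) :
    (E₁div P i).toDual (g P ^ a * x P ^ (P.m * L + r)) = if r = i then 0 ^ L else 0 := by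
  have := psi_mul_E₁div_apply 0 hi a L hr
  rwa [psi_zero, one_mul] at this

theorem omega_pow_mul_E₁div_apply (s : ℕ) {i : ℕ} (hi : i < P.m) (a L : ℕ) {r : ℕ} (hr : r < P.m) :
    (omega P ^ s * E₁div P i).toDual (g P ^ a * x P ^ (P.m * L + r)) =
      if r = i then P.ξ ^ (s * a) * 0 ^ L else 0 := by
  have := psi_mul_mul_E₁div_apply (hasSymbol_omega_pow s) 0 hi a L hr
  rwa [psi_zero, one_mul] at this

theorem omega_pow_apply (s a L : ℕ) {r : ℕ} (hr : r < P.m) :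
    (omega P ^ s).toDual (g P ^ a * x P ^ (P.m * L + r)) =
      if r = 0 then P.ξ ^ (s * a) * 0 ^ L else 0 := by
  have := omega_pow_mul_E₁div_apply s P.m_pos a L hr
  rwa [E₁div_zero, mul_one] at this

theorem pair₂_cross (a L r a' L' r' : ℕ) (hr : r < P.m) (hr' : r' < P.m) :
    FiniteDual.pair₂ (cross P)
      ((g P ^ a * x P ^ (P.m * L + r)) ⊗ₜ (g P ^ a' * x P ^ (P.m * L' + r'))) =
        if r + r' = P.m then P.ξ ^ (r * a') * 0 ^ L * 0 ^ L' else 0 := by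
  have h : ∀ i ∈ Finset.Ico 1 P.m,
      FiniteDual.pair₂ (E₁div P i ⊗ₜ[k] (omega P ^ i * E₁div P (P.m - i)))
        ((g P ^ a * x P ^ (P.m * L + r)) ⊗ₜ (g P ^ a' * x P ^ (P.m * L' + r'))) =
      if r = i then (if r + r' = P.m then P.ξ ^ (r * a') * 0 ^ L * 0 ^ L' else 0) else 0 := by
    intro i hi
    rw [Finset.mem_Ico] at hi
    rw [FiniteDual.pair₂_tmul, E₁div_apply hi.2 _ _ hr,
      omega_pow_mul_E₁div_apply _ (by lia) _ _ hr']
    by_cases h1 : r = i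
    · subst h1
      have h2 : r' = P.m - r ↔ r + r' = P.m := by lia
      simp only [h2, if_true]
      split_ifs <;> ring
    · simp [h1]
  rw [cross, map_sum, LinearMap.sum_apply, Finset.sum_congr rfl h, Finset.sum_ite_eq]
  by_cases h1 : r + r' = P.m
  · rw [if_pos (Finset.mem_Ico.2 (by lia))]
  · simp [h1]

theorem comul_E₂ : FiniteDual.comul (E₂ P) =
    1 ⊗ₜ[k] E₂ P + E₂ P ⊗ₜ[k] (omega P ^ P.m) + cross P := by
  refine comul_eq_of_pair₂_of_lt fun a L r a' L' r' hr hr' => ?_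
  have key : P.m * L + r + (P.m * L' + r') = P.m ↔
      (r = 0 ∧ r' = 0 ∧ L + L' = 1) ∨ (r + r' = P.m ∧ L = 0 ∧ L' = 0) := by
    rcases h : L + L' with _ | _ | N
    · obtain ⟨rfl, rfl⟩ : L = 0 ∧ L' = 0 := by lia
      simp
    · have : P.m * L + P.m * L' = P.m := by rw [← Nat.mul_add, h]; simp
      lia
    · have : P.m * L + P.m * L' = P.m * N + P.m + P.m := by rw [← Nat.mul_add, h]; ring
      lia
  rw [map_add, map_add, LinearMap.add_apply, LinearMap.add_apply, pair₂_cross _ _ _ _ _ _ hr hr',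
    FiniteDual.pair₂_tmul, FiniteDual.pair₂_tmul, E₂_apply' _ _ hr, E₂_apply' _ _ hr',
    omega_pow_apply _ _ _ hr', ← E₁div_zero, E₁div_apply P.m_pos _ _ hr, E₂_apply]
  simp only [key]
  have hm := P.m_pos
  by_cases h1 : r + r' = P.m
  · have h2 : ¬(r = 0 ∧ r' = 0) := by lia
    rcases L with _ | L <;> rcases L' with _ | L' <;> by_cases h0 : r = 0 <;> simp_all
  · by_cases h0 : r = 0 <;> by_cases h0' : r' = 0 <;> rcases L with _ | _ | L <;>
      rcases L' with _ | _ | L' <;> simp_all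
    exact fun h => absurd h (by lia)

theorem comul_psi (lam : k) : FiniteDual.comul (psi P lam) =
    ∑ c ∈ Finset.range (P.n / P.m),
      (psi P (lam * P.ξ ^ (P.m * c)) ⊗ₜ[k] (psi P lam * indicator P c)) *
        ((1 ⊗ₜ[k] 1) + lam • cross P) := by
  refine comul_eq_of_pair₂_of_lt fun a L r a' L' r' hr hr' => ?_
  have hpos : 0 < P.n / P.m := Nat.div_pos P.m_le P.m_pos
  have hF : ∀ c ∈ Finset.range (P.n / P.m), FiniteDual.pair₂
      ((psi P (lam * P.ξ ^ (P.m * c)) ⊗ₜ[k] (psi P lam * indicator P c)) *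
        ((1 ⊗ₜ[k] 1) + lam • cross P))
      ((g P ^ a * x P ^ (P.m * L + r)) ⊗ₜ (g P ^ a' * x P ^ (P.m * L' + r'))) =
      if a' ≡ c [MOD P.n / P.m] then
        (lam * P.ξ ^ (P.m * c)) ^ L * lam ^ L' * ((if r = 0 ∧ r' = 0 then 1 else 0) +
          lam * if r + r' = P.m then P.ξ ^ (r * a') else 0)
      else 0 := by
    intro c _
    have hi : ∀ i ∈ Finset.Ico 1 P.m, FiniteDual.pair₂
        ((psi P (lam * P.ξ ^ (P.m * c)) * E₁div P i) ⊗ₜ[k]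
          (psi P lam * indicator P c * (omega P ^ i * E₁div P (P.m - i))))
        ((g P ^ a * x P ^ (P.m * L + r)) ⊗ₜ (g P ^ a' * x P ^ (P.m * L' + r'))) =
        if r = i then (if a' ≡ c [MOD P.n / P.m] then (lam * P.ξ ^ (P.m * c)) ^ L * lam ^ L' *
          if r + r' = P.m then P.ξ ^ (r * a') else 0 else 0) else 0 := by
      intro i hi
      rw [Finset.mem_Ico] at hi
      rw [FiniteDual.pair₂_tmul, psi_mul_E₁div_apply _ hi.2 _ _ hr, ← mul_assoc,
        mul_assoc (psi P lam),
        psi_mul_mul_E₁div_apply (((hasSymbol_indicator c).mul (hasSymbol_omega_pow i)).congr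
          (fun _ => rfl) rfl (one_mul 1)) _ (by lia) _ _ hr']
      by_cases h1 : r = i
      · subst h1
        have h2 : r' = P.m - r ↔ r + r' = P.m := by lia
        simp only [h2, if_true, mul_zero, add_zero]
        split_ifs <;> ring
      · simp [h1]
    rw [mul_add, ← Algebra.TensorProduct.one_def, mul_one, mul_smul_comm, cross, Finset.mul_sum,
      map_add, map_smul, map_sum, LinearMap.add_apply, LinearMap.smul_apply, LinearMap.sum_apply]
    simp only [Algebra.TensorProduct.tmul_mul_tmul]
    rw [Finset.sum_congr rfl hi, Finset.sum_ite_eq, FiniteDual.pair₂_tmul,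
      psi_mul_apply (hasSymbol_indicator c) _ _ _ hr', ← mul_one (psi P (lam * P.ξ ^ (P.m * c))),
      psi_mul_apply HasSymbol.one _ _ _ hr]
    have hmem : r + r' = P.m → r ∈ Finset.Ico 1 P.m := fun h => Finset.mem_Ico.2 (by lia)
    by_cases h1 : a' ≡ c [MOD P.n / P.m]
    · by_cases h2 : r + r' = P.m
      · have h4 : r ≠ 0 := by lia
        simp [h1, h2, h4, hmem h2]
        ring
      · simp only [h1, h2, if_true, if_false, mul_zero, add_zero, ite_self, smul_zero]
        by_cases h3 : r = 0 <;> by_cases h4 : r' = 0 <;> simp [h3, h4]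
    · simp [h1]
  rw [map_sum, LinearMap.sum_apply, Finset.sum_congr rfl hF,
    Finset.sum_eq_single_of_mem (a' % (P.n / P.m)) (Finset.mem_range.2 (Nat.mod_lt _ hpos)),
    if_pos (Nat.mod_modEq _ _).symm, psi_apply]
  · have h1 : P.ξ ^ (P.m * (a' % (P.n / P.m))) = P.ξ ^ (P.m * a') := by
      refine P.ξ_pow_congr ?_
      have := (Nat.mod_modEq a' (P.n / P.m)).mul_left' P.m
      rwa [Nat.mul_div_cancel' P.m_dvd] at this
    have hm := P.m_pos
    -- Both sides vanish unless `r = r' = 0` or `r + r' = m`, as `r, r' < m`.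
    rw [h1, show P.m * L + r + (P.m * L' + r') = P.m * (L + L') + (r + r') by ring,
      Nat.mul_add_div hm]
    simp only [Nat.dvd_add_right (dvd_mul_right P.m (L + L'))]
    by_cases h2 : r + r' = P.m
    · have h3 : ¬(r = 0 ∧ r' = 0) := by lia
      rw [if_neg h3, if_pos h2, h2, if_pos dvd_rfl, Nat.div_self hm]
      ring
    · by_cases h3 : r = 0 ∧ r' = 0
      · obtain ⟨rfl, rfl⟩ := h3
        simp [hm.ne]
        ring
      · have h4 : ¬P.m ∣ r + r' := by
          rintro ⟨N, hN⟩
          rcases N with _ | _ | N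
          · lia
          · lia
          · have : P.m * (N + 1 + 1) = P.m * N + P.m + P.m := by ring
            lia
        simp [h2, h3, h4]
  · intro c hc hne
    rw [if_neg]
    intro h
    exact hne (by rw [h, Nat.mod_eq_of_lt (Finset.mem_range.1 hc)])

end Taft

/-! ### Antipode of the generating functionals -/

namespace Taft

variable {k : Type*} [Field k] {P : TaftParams k}

theorem antipode_eq (a : Taft P) : HopfAlgebra.antipode k a = antipode a := rfl

theorem antipode_pow (a : Taft P) (l : ℕ) : antipode (a ^ l) = antipode a ^ l := by
  induction l with
  | zero => simp [antipode_one]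
  | succ l ih => rw [pow_succ, antipode_mul, ih, ← pow_succ']

theorem antipode_monomial (a l : ℕ) : antipode (g P ^ a * x P ^ l) =
    antipode (x P) ^ l * g P ^ ((P.n - 1) * a) := by
  rw [antipode_mul, antipode_pow, antipode_pow, antipode_g, pow_mul]

theorem exists_antipode_monomial (a l : ℕ) :
    ∃ (c : k) (b : ℕ), antipode (g P ^ a * x P ^ l) = c • (g P ^ b * x P ^ l) := by
  have h : ∃ (c : k) (b : ℕ), antipode (x P) ^ l = c • (g P ^ b * x P ^ l) := by
    induction l with
    | zero => exact ⟨1, 0, by simp⟩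
    | succ l ih =>
      obtain ⟨c, b, h⟩ := ih
      rw [pow_succ, h, antipode_x, ← neg_smul, smul_mul_smul_comm, mul_assoc, ← mul_assoc (x P ^ l),
        x_pow_mul_g_pow, smul_mul_assoc, mul_smul_comm, smul_smul]
      exact ⟨_, b + (P.n - P.v), congrArg (_ • ·) (by simp only [pow_add, pow_succ, mul_assoc])⟩
  obtain ⟨c, b, h⟩ := h
  rw [antipode_monomial, h, smul_mul_assoc, mul_assoc, x_pow_mul_g_pow, mul_smul_comm, smul_smul]
  exact ⟨_, b + (P.n - 1) * a, congrArg (_ • ·) (by simp only [pow_add, mul_assoc])⟩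

/-- As `x ^ m` is primitive, the antipode negates it. -/
theorem antipode_x_pow_m [CharZero k] : antipode (x P ^ P.m) = -x P ^ P.m := by
  have h := HopfAlgebra.mul_antipode_rTensor_comul_apply (R := k) (x P ^ P.m)
  rw [comul_x_pow_m, map_add, map_add, LinearMap.rTensor_tmul, LinearMap.rTensor_tmul,
    LinearMap.mul'_apply, LinearMap.mul'_apply, antipode_eq, antipode_eq, antipode_one, one_mul,
    mul_one, Bialgebra.counit_pow, counit_x, zero_pow P.m_pos.ne', map_zero] at h
  exact (neg_eq_of_add_eq_zero_right h).symm

theorem antipode_monomial_mul_m [CharZero k] (a L : ℕ) : antipode (g P ^ a * x P ^ (P.m * L)) =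
    ((-1) ^ L * P.ξ ^ (P.m * L * ((P.n - 1) * a))) •
      (g P ^ ((P.n - 1) * a) * x P ^ (P.m * L)) := by
  have h : (-1 : Taft P) ^ L = ((-1 : k) ^ L) • 1 := by
    rw [← Algebra.algebraMap_eq_smul_one]
    simp
  rw [antipode_monomial, pow_mul (antipode (x P)), ← antipode_pow, antipode_x_pow_m, neg_pow, h,
    smul_mul_assoc, one_mul, smul_mul_assoc, ← pow_mul (x P), x_pow_mul_g_pow, smul_smul]

theorem antipode_apply (f : FiniteDual k (Taft P)) (a : Taft P) :
    (FiniteDual.antipode f).toDual a = f.toDual (antipode a) := rfl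

/-- Since the antipode multiplies `x ^ l` by a scalar and a power of `g`, a formula for the antipode
of `f` need only be checked on the monomials with `l` in the support of `f`. -/
theorem antipode_eq_of_support {f f' : FiniteDual k (Taft P)} (s : ℕ → Prop)
    (hf : ∀ a l, ¬s l → f.toDual (g P ^ a * x P ^ l) = 0)
    (hf' : ∀ a l, ¬s l → f'.toDual (g P ^ a * x P ^ l) = 0)
    (h : ∀ a l, s l → f.toDual (antipode (g P ^ a * x P ^ l)) = f'.toDual (g P ^ a * x P ^ l)) :
    FiniteDual.antipode f = f' := by
  refine FiniteDual.toDual_injective (linearMap_ext fun a l => ?_)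
  rw [antipode_apply]
  by_cases hl : s l
  · exact h a l hl
  · obtain ⟨c, b, e⟩ := exists_antipode_monomial (P := P) a l
    rw [e, map_smul, hf b l hl, hf' a l hl, smul_zero]

theorem HasSymbol.apply_x_pow_eq_zero [CharZero k] {f : FiniteDual k (Taft P)} {χ : ℕ → k}
    {p : PowerSeries k} (h : HasSymbol f χ 0 p) {a l : ℕ} (hl : ¬P.m ∣ l) :
    f.toDual (g P ^ a * x P ^ l) = 0 := by
  rw [← Nat.div_add_mod l P.m, h.apply_x_pow a _ (Nat.mod_lt _ P.m_pos), if_neg]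
  rwa [Nat.dvd_iff_mod_eq_zero] at hl

theorem toDual_neg (f : FiniteDual k (Taft P)) (a : Taft P) : (-f).toDual a = -f.toDual a := by
  rw [map_neg, LinearMap.neg_apply]

variable [CharZero k]

theorem antipode_E₁ : FiniteDual.antipode (E₁ P) =
    -((P.ξ⁻¹) ^ P.v • (omega P ^ (P.n - 1) * E₁ P)) := by
  by_cases hm : P.m = 1
  · simp [E₁_eq_zero hm]
  have hE : ∀ j l, (E₁ P).toDual (g P ^ j * x P ^ l) = if l = 1 then 1 else 0 := fun j l => by
    rw [E₁, if_neg (fun h => hm (P.m_eq_one_iff.2 h)), dualX_apply]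
  have hw : ∀ j l, (omega P ^ (P.n - 1) * E₁ P).toDual (g P ^ j * x P ^ l) =
      if l = 1 then P.ξ ^ ((P.n - 1) * j) else 0 := by
    intro j l
    have hs := ((hasSymbol_omega_pow (P := P) (P.n - 1)).mul (hasSymbol_E₁ hm)).apply_x_pow j
      (l / P.m) (Nat.mod_lt l P.m_pos)
    rw [Nat.div_add_mod] at hs
    simp only [hs, mul_one, zero_add, PowerSeries.coeff_one]
    have hm' : 1 < P.m := by have := P.m_pos; lia
    by_cases hl : l = 1
    · subst hl
      simp [Nat.mod_eq_of_lt hm', Nat.div_eq_of_lt hm', qFactorial_one]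
    · rw [if_neg hl]
      split_ifs with h1 h2
      · exact absurd (by rw [← Nat.div_add_mod l P.m, h1, h2]; simp) hl
      · simp
      · rfl
  refine antipode_eq_of_support (fun l => l = 1) (fun a l hl => by rw [hE, if_neg hl])
    (fun a l hl => ?_) ?_
  · rw [toDual_neg, map_smul, LinearMap.smul_apply, hw, if_neg hl, smul_zero, neg_zero]
  · rintro a _ rfl
    rw [toDual_neg, map_smul, LinearMap.smul_apply, hw, antipode_monomial, pow_one, antipode_x,
      neg_mul, smul_mul_assoc, mul_assoc, x_mul_g_pow, mul_smul_comm, ← mul_assoc, ← pow_add,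
      map_neg, map_smul, map_smul, ← pow_one (x P), hE]
    simp

theorem hasSymbol_antipode_E₂ : HasSymbol (omega P ^ (P.n - P.m) * E₂ P)
    (fun a => P.ξ ^ ((P.n - P.m) * a)) 0 PowerSeries.X :=
  ((hasSymbol_omega_pow _).mul hasSymbol_E₂).congr (by simp) rfl (one_mul _)

theorem antipode_E₂ : FiniteDual.antipode (E₂ P) = -(omega P ^ (P.n - P.m) * E₂ P) := by
  refine antipode_eq_of_support (fun l => P.m ∣ l)
    (fun a l hl => hasSymbol_E₂.apply_x_pow_eq_zero hl)
    (fun a l hl => by rw [toDual_neg, hasSymbol_antipode_E₂.apply_x_pow_eq_zero hl, neg_zero]) ?_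
  rintro a _ ⟨L, rfl⟩
  have h1 := hasSymbol_E₂.apply_x_pow ((P.n - 1) * a) L P.m_pos
  have h2 := hasSymbol_antipode_E₂.apply_x_pow a L P.m_pos
  rw [add_zero, if_pos rfl, PowerSeries.coeff_X] at h1 h2
  rw [antipode_monomial_mul_m, map_smul, toDual_neg, h1, h2]
  by_cases hL : L = 1
  · subst hL
    have h3 : P.ξ ^ (P.m * 1 * ((P.n - 1) * a)) = P.ξ ^ ((P.n - P.m) * a) := by
      refine P.ξ_pow_congr ?_
      have h4 : P.m * (P.n - 1) ≡ P.n - P.m [MOD P.n] := by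
        refine (Nat.modEq_iff_dvd.2 ⟨1 - P.m, ?_⟩)
        push_cast [Nat.cast_sub P.m_le, Nat.cast_sub P.n_pos]
        ring
      simpa [mul_assoc] using h4.mul_right a
    rw [h3]
    simp [qFactorial_zero]
  · simp [hL]

theorem antipode_omega : FiniteDual.antipode (omega P) = omega P ^ (P.n - 1) := by
  refine antipode_eq_of_support (fun l => P.m ∣ l)
    (fun a l hl => hasSymbol_omega.apply_x_pow_eq_zero hl)
    (fun a l hl => (hasSymbol_omega_pow _).apply_x_pow_eq_zero hl) ?_
  rintro a _ ⟨L, rfl⟩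
  have h1 := hasSymbol_omega.apply_x_pow (P := P) ((P.n - 1) * a) L P.m_pos
  have h2 := (hasSymbol_omega_pow (P := P) (P.n - 1)).apply_x_pow a L P.m_pos
  rw [add_zero, if_pos rfl, PowerSeries.coeff_one] at h1 h2
  rw [antipode_monomial_mul_m, map_smul, h1, h2]
  by_cases hL : L = 0 <;> simp [hL]

theorem antipode_psi [IsAlgClosed k] (lam : k) : FiniteDual.antipode (psi P lam) =
    ∑ c ∈ Finset.range (P.n / P.m), psi P (-lam * (P.ξ⁻¹) ^ (P.m * c)) * indicator P c := by
  have hpos : 0 < P.n / P.m := Nat.div_pos P.m_le P.m_pos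
  refine antipode_eq_of_support (fun l => P.m ∣ l)
    (fun a l hl => (hasSymbol_psi lam).apply_x_pow_eq_zero hl)
    (fun a l hl => ?_) ?_
  · rw [map_sum, LinearMap.sum_apply]
    exact Finset.sum_eq_zero fun c _ =>
      ((hasSymbol_psi _).mul (hasSymbol_indicator c)).apply_x_pow_eq_zero hl
  · rintro a _ ⟨L, rfl⟩
    have h1 : ∀ c, (psi P (-lam * (P.ξ⁻¹) ^ (P.m * c)) * indicator P c).toDual
        (g P ^ a * x P ^ (P.m * L)) = if a ≡ c [MOD P.n / P.m] then
          (-lam * (P.ξ⁻¹) ^ (P.m * c)) ^ L else 0 := by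
      intro c
      have := psi_mul_apply (hasSymbol_indicator c) (-lam * (P.ξ⁻¹) ^ (P.m * c)) a L P.m_pos
      rw [add_zero] at this
      rw [this]
      simp
    rw [map_sum, LinearMap.sum_apply, Finset.sum_congr rfl fun c _ => h1 c,
      Finset.sum_eq_single_of_mem (a % (P.n / P.m)) (Finset.mem_range.2 (Nat.mod_lt _ hpos)),
      if_pos (Nat.mod_modEq _ _).symm, antipode_monomial_mul_m, map_smul, psi_apply,
      if_pos (dvd_mul_right _ _), Nat.mul_div_cancel_left _ P.m_pos]
    · have h2 : P.ξ ^ (P.m * (a % (P.n / P.m))) = P.ξ ^ (P.m * a) := by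
        refine P.ξ_pow_congr ?_
        have := (Nat.mod_modEq a (P.n / P.m)).mul_left' P.m
        rwa [Nat.mul_div_cancel' P.m_dvd] at this
      have h3 : P.ξ⁻¹ = P.ξ ^ (P.n - 1) := by
        refine inv_eq_of_mul_eq_one_right ?_
        rw [← pow_succ', Nat.sub_add_cancel P.n_pos, P.primitive.pow_eq_one]
      rw [inv_pow, h2, ← inv_pow, h3, neg_mul, neg_pow, smul_eq_mul]
      ring
    · intro c hc hne
      rw [if_neg]
      intro h
      exact hne (by rw [h, Nat.mod_eq_of_lt (Finset.mem_range.1 hc)])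

end Taft

/-! ### Transport of Hopf algebra structures -/

namespace HopfStructure

variable {k A B : Type*} [CommRing k] [Ring A] [Algebra k A] [Ring B] [Algebra k B]

/-- The comultiplication of `A` transported from `B`. -/
def transportComul (N : HopfStructure k B) (e : A ≃ₐ[k] B) : A →ₐ[k] A ⊗[k] A :=
  (Algebra.TensorProduct.congr e e).symm.toAlgHom.comp (N.comul.comp e.toAlgHom)

theorem congr_transportComul (N : HopfStructure k B) (e : A ≃ₐ[k] B) (a : A) :
    Algebra.TensorProduct.congr e e (N.transportComul e a) = N.comul (e a) :=
  (Algebra.TensorProduct.congr e e).apply_symm_apply _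

/-- The Hopf algebra structure on `A` for which the algebra isomorphism `e : A ≃ B` is an
isomorphism of Hopf algebras. -/
def transport (N : HopfStructure k B) (e : A ≃ₐ[k] B) : HopfStructure k A where
  comul := N.transportComul e
  counit := N.counit.comp e.toAlgHom
  antipode := e.symm.toLinearMap ∘ₗ N.antipode ∘ₗ e.toLinearMap
  coassoc := by
    have h1 : ∀ (u : A ⊗[k] A) (b : A),
        Algebra.TensorProduct.congr e (Algebra.TensorProduct.congr e e)
          (Algebra.TensorProduct.assoc k k k A A A (u ⊗ₜ b)) =
        Algebra.TensorProduct.assoc k k k B B B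
          (Algebra.TensorProduct.congr e e u ⊗ₜ e b) := by
      intro u b
      induction u with
      | zero => simp
      | add x y hx hy => simp only [TensorProduct.add_tmul, map_add, hx, hy]
      | tmul a a' => simp
    have h2 : ∀ t : A ⊗[k] A,
        Algebra.TensorProduct.congr e (Algebra.TensorProduct.congr e e)
          (Algebra.TensorProduct.assoc k k k A A A
            (Algebra.TensorProduct.map (N.transportComul e) (.id k A) t)) =
        Algebra.TensorProduct.assoc k k k B B B
          (Algebra.TensorProduct.map N.comul (.id k B) (Algebra.TensorProduct.congr e e t)) := by
      intro t
      induction t with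
      | zero => simp
      | add x y hx hy => simp only [map_add, hx, hy]
      | tmul a a' =>
        rw [Algebra.TensorProduct.map_tmul, h1, congr_transportComul]
        simp
    have h3 : ∀ t : A ⊗[k] A,
        Algebra.TensorProduct.congr e (Algebra.TensorProduct.congr e e)
          (Algebra.TensorProduct.map (.id k A) (N.transportComul e) t) =
        Algebra.TensorProduct.map (.id k B) N.comul (Algebra.TensorProduct.congr e e t) := by
      intro t
      induction t with
      | zero => simp
      | add x y hx hy => simp only [map_add, hx, hy]
      | tmul a a' =>
        change e a ⊗ₜ[k] Algebra.TensorProduct.congr e e (N.transportComul e a') =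
          e a ⊗ₜ[k] N.comul (e a')
        rw [congr_transportComul]
    refine AlgHom.ext fun a => ?_
    apply (Algebra.TensorProduct.congr e (Algebra.TensorProduct.congr e e)).injective
    refine (h2 (N.transportComul e a)).trans (Eq.trans ?_ (h3 (N.transportComul e a)).symm)
    rw [congr_transportComul]
    exact AlgHom.congr_fun N.coassoc (e a)
  counit_left := by
    have h : ∀ t : A ⊗[k] A, e (TensorProduct.lid k A
        (Algebra.TensorProduct.map (N.counit.comp e.toAlgHom) (.id k A) t)) =
        TensorProduct.lid k B (Algebra.TensorProduct.map N.counit (.id k B)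
          (Algebra.TensorProduct.congr e e t)) := by
      intro t
      induction t with
      | zero => simp
      | add x y hx hy => simp only [map_add, hx, hy]
      | tmul a a' => simp
    refine AlgHom.ext fun a => ?_
    apply (TensorProduct.lid k A).injective
    apply e.injective
    refine (h (N.transportComul e a)).trans ?_
    rw [congr_transportComul]
    refine (congrArg (TensorProduct.lid k B) (AlgHom.congr_fun N.counit_left (e a))).trans ?_
    simp
  counit_right := by
    have h : ∀ t : A ⊗[k] A, e (TensorProduct.rid k A
        (Algebra.TensorProduct.map (.id k A) (N.counit.comp e.toAlgHom) t)) =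
        TensorProduct.rid k B (Algebra.TensorProduct.map (.id k B) N.counit
          (Algebra.TensorProduct.congr e e t)) := by
      intro t
      induction t with
      | zero => simp
      | add x y hx hy => simp only [map_add, hx, hy]
      | tmul a a' => simp
    refine AlgHom.ext fun a => ?_
    apply (TensorProduct.rid k A).injective
    apply e.injective
    refine (h (N.transportComul e a)).trans ?_
    rw [congr_transportComul]
    refine (congrArg (TensorProduct.rid k B) (AlgHom.congr_fun N.counit_right (e a))).trans ?_
    simp
  antipode_left a := by
    have h : ∀ t : A ⊗[k] A, e (LinearMap.mul' k A
        ((e.symm.toLinearMap ∘ₗ N.antipode ∘ₗ e.toLinearMap).rTensor A t)) =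
        LinearMap.mul' k B (N.antipode.rTensor B (Algebra.TensorProduct.congr e e t)) := by
      intro t
      induction t with
      | zero => simp
      | add x y hx hy => simp only [map_add, hx, hy]
      | tmul a a' => simp
    apply e.injective
    rw [h, congr_transportComul, N.antipode_left]
    simp
  antipode_right a := by
    have h : ∀ t : A ⊗[k] A, e (LinearMap.mul' k A
        ((e.symm.toLinearMap ∘ₗ N.antipode ∘ₗ e.toLinearMap).lTensor A t)) =
        LinearMap.mul' k B (N.antipode.lTensor B (Algebra.TensorProduct.congr e e t)) := by
      intro t
      induction t with
      | zero => simp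
      | add x y hx hy => simp only [map_add, hx, hy]
      | tmul a a' => simp
    apply e.injective
    rw [h, congr_transportComul, N.antipode_right]
    simp

end HopfStructure

namespace Taft

variable {k : Type*} [Field k] [CharZero k] [IsAlgClosed k] {P : TaftParams k}

/-- The Hopf algebra structure on `TaftDual P` that corresponds to the one of the finite dual. -/
def dualHopfStructure (P : TaftParams k) : HopfStructure k (TaftDual P) :=
  FiniteDual.hopfStructure.transport (thetaEquiv P)

/-- An identity for the comultiplication of `TaftDual P` is one between elements of `H° ⊗ H°`. -/
theorem dualHopfStructure_comul_eq_iff {a : TaftDual P} {t : TaftDual P ⊗[k] TaftDual P} :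
    (dualHopfStructure P).comul a = t ↔
      FiniteDual.comul (theta P a) = Algebra.TensorProduct.map (theta P) (theta P) t := by
  rw [← (Algebra.TensorProduct.congr (thetaEquiv P) (thetaEquiv P)).injective.eq_iff]
  exact Eq.congr_left (HopfStructure.congr_transportComul _ _ _)

theorem dualHopfStructure_antipode_eq_iff {a b : TaftDual P} :
    (dualHopfStructure P).antipode a = b ↔ FiniteDual.antipode (theta P a) = theta P b :=
  (thetaEquiv P).symm_apply_eq

theorem theta_F₁div (i : ℕ) : theta P (TaftDual.F₁div P i) = E₁div P i := by
  simp [TaftDual.F₁div, E₁div]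

theorem theta_varsigma (c : ℕ) : theta P (TaftDual.varsigma P c) = indicator P c := by
  simp [TaftDual.varsigma, indicator]

theorem map_theta_crossTerm : Algebra.TensorProduct.map (theta P) (theta P) (TaftDual.crossTerm P) =
    cross P := by
  simp [TaftDual.crossTerm, cross, theta_F₁div]

theorem hasStandardFormulas : TaftDual.HasStandardFormulas (dualHopfStructure P) where
  comul_Omega := by
    rw [dualHopfStructure_comul_eq_iff, theta_Omega, comul_omega]
    simp
  comul_F₁ := by
    rw [dualHopfStructure_comul_eq_iff, theta_F₁, comul_E₁]
    simp
  comul_F₂ := by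
    rw [dualHopfStructure_comul_eq_iff, theta_F₂, comul_E₂]
    simp [map_theta_crossTerm]
  comul_Psi lam := by
    rw [dualHopfStructure_comul_eq_iff, theta_Psi, comul_psi]
    simp [map_theta_crossTerm, theta_varsigma]
  counit_Omega := by
    change (theta P (TaftDual.Omega P)).toDual 1 = 1
    simpa using omega_apply (P := P) 0 0
  counit_Psi lam := by
    change (theta P (TaftDual.Psi P lam)).toDual 1 = 1
    simpa using psi_apply (P := P) lam 0 0
  counit_F₁ := by
    change (theta P (TaftDual.F₁ P)).toDual 1 = 0
    rw [theta_F₁, E₁]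
    split_ifs
    · simp
    · simpa using dualX_apply (P := P) 1 0 0
  counit_F₂ := by
    change (theta P (TaftDual.F₂ P)).toDual 1 = 0
    simpa [P.m_pos.ne] using E₂_apply (P := P) 0 0
  antipode_Omega := by
    rw [dualHopfStructure_antipode_eq_iff, theta_Omega, antipode_omega]
    simp
  antipode_F₁ := by
    rw [dualHopfStructure_antipode_eq_iff, theta_F₁, antipode_E₁]
    simp
  antipode_F₂ := by
    rw [dualHopfStructure_antipode_eq_iff, theta_F₂, antipode_E₂]
    simp
  antipode_Psi lam := by
    rw [dualHopfStructure_antipode_eq_iff, theta_Psi, antipode_psi]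
    simp [theta_varsigma]

end Taft

end

theorem theorem3p4 {k : Type*} [Field k] [IsAlgClosed k] [CharZero k] (P : TaftParams k) :
    ∃ M : HopfStructure k (TaftDual P), TaftDual.HasStandardFormulas M ∧
      letI : HopfAlgebra k (TaftDual P) := M.toHopfAlgebra
      ∃ Θ : TaftDual P ≃ₐc[k] FiniteDual k (Taft P),
        (∀ a : TaftDual P, Θ (HopfAlgebra.antipode k a) = HopfAlgebra.antipode k (Θ a)) ∧
        (∀ (lam : k) (j l : ℕ),
          (Θ (TaftDual.Psi P lam)).toDual (Taft.g P ^ j * Taft.x P ^ l) =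
            if P.m ∣ l then lam ^ (l / P.m) else 0) ∧
        (∀ j l : ℕ, (Θ (TaftDual.Omega P)).toDual (Taft.g P ^ j * Taft.x P ^ l) =
            if l = 0 then P.ξ ^ j else 0) ∧
        (∀ j l : ℕ, (Θ (TaftDual.F₂ P)).toDual (Taft.g P ^ j * Taft.x P ^ l) =
            if l = P.m then 1 else 0) ∧
        (P.v ≠ 0 → ∀ j l : ℕ, (Θ (TaftDual.F₁ P)).toDual (Taft.g P ^ j * Taft.x P ^ l) =
            if l = 1 then 1 else 0) ∧
        (P.v = 0 → Θ (TaftDual.F₁ P) = 0) := by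
  refine ⟨Taft.dualHopfStructure P, Taft.hasStandardFormulas, ?_⟩
  let : HopfAlgebra k (TaftDual P) := (Taft.dualHopfStructure P).toHopfAlgebra
  have h₁ : (Bialgebra.counitAlgHom k (FiniteDual k (Taft P))).comp (Taft.thetaEquiv P).toAlgHom =
      Bialgebra.counitAlgHom k (TaftDual P) := AlgHom.ext fun _ => rfl
  have h₂ : (Algebra.TensorProduct.map (Taft.thetaEquiv P).toAlgHom
      (Taft.thetaEquiv P).toAlgHom).comp (Bialgebra.comulAlgHom k (TaftDual P)) =
      (Bialgebra.comulAlgHom k (FiniteDual k (Taft P))).comp (Taft.thetaEquiv P).toAlgHom :=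
    AlgHom.ext fun a => HopfStructure.congr_transportComul _ _ a
  have hΘ : ∀ a, BialgEquiv.ofAlgEquiv (Taft.thetaEquiv P) h₁ h₂ a = Taft.theta P a := fun _ => rfl
  refine ⟨BialgEquiv.ofAlgEquiv (Taft.thetaEquiv P) h₁ h₂, fun a => ?_, fun lam j l => ?_,
    fun j l => ?_, fun j l => ?_, fun hv j l => ?_, fun hv => ?_⟩
  · exact (Taft.dualHopfStructure_antipode_eq_iff.1 rfl).symm
  · rw [hΘ, Taft.theta_Psi, Taft.psi_apply]
  · rw [hΘ, Taft.theta_Omega, Taft.omega_apply]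
  · rw [hΘ, Taft.theta_F₂, Taft.E₂_apply]
  · rw [hΘ, Taft.theta_F₁, Taft.E₁, if_neg hv, Taft.dualX_apply]
  · rw [hΘ, Taft.theta_F₁, Taft.E₁, if_pos hv]
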